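/- Let $G$ be a finite connected $2$-$2$-regular directed multigraph (every vertex has exactly two incoming and exactly two outgoing edges; loops and parallel edges are allowed) with a rotation system, i.e. a clockwise cyclic order of the edge ends at each vertex. Assume that the rotation system describes a cellular embedding in the torus, i.e. that $|V|-|E|+|F|=0$, where $F$ is the set of faces, obtained by tracing the facial walks. A directed circuit is a nonempty closed directed walk that repeats no edge (vertices may be repeated). A closed walk is contractible if it is null-homotopic in the surface, i.e. if it can be transformed into a constant walk by finitely many insertions and deletions of spurs (an edge traversed back and forth) and of facial walks. A face is bounded by a directed circuit $C$ if its facial walk is $C$, traversed forwards or backwards. (a) If $G$ contains a contractible directed circuit, then some face of $G$ is bounded by a contractible directed circuit. (b) Consequently, the condition (C3) all directed circuits of $G$ are non-contractible holds if and only if no facial walk of $G$ is a directed circuit (traversed forwards or backwards). (c) Condition (C3) can be tested in linear time: there are a program for a random access machine (with constants, addition, truncated subtraction, indirect loads and stores, and jumps on zero, at unit cost) and a constant $K$ such that, for every $n$ and every such $G$ with vertices $0,\dots,n-1$ and edges numbered $0,\dots,2n-1$, given as $n$ followed by the clockwise lists of the four edge ends at each vertex, the program halts after at most $Kn$ steps,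 never holds a number larger than $Kn$ in a register or memory cell, and outputs $1$ if (C3) holds and $0$ otherwise. -/

import Mathlib

/-- A directed multigraph (loops and parallel edges allowed) with a rotation system.

A *dart* `(e, b) : E × Bool` is the edge `e` together with a direction of traversal: `(e, true)` runs
along `e` from its source to its target and `(e, false)` runs against it. A dart also stands for the
end of `e` at the vertex that the dart leaves, so the ends of edges at a vertex `v` are the darts with
tail `v`; a loop has two ends at its vertex. The permutation `rot` sends each edge end to the next one
in clockwise order around its vertex. -/
structure RotationDigraph (V E : Type*) where
  src : E → V
  tgt : E → V
  rot : Equiv.Perm (E × Bool)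
  /-- `rot` stays at the same vertex. -/
  tail_rot : ∀ d : E × Bool,
    (if (rot d).2 then src (rot d).1 else tgt (rot d).1) = (if d.2 then src d.1 else tgt d.1)
  /-- All the edge ends at a vertex form a single cyclic order. -/
  sameCycle_rot : ∀ d d' : E × Bool,
    (if d.2 then src d.1 else tgt d.1) = (if d'.2 then src d'.1 else tgt d'.1) →
      rot.SameCycle d d'

namespace RotationDigraph

variable {V E : Type*} (G : RotationDigraph V E)

/-- The dart that traverses the same edge in the opposite direction. -/
def rev : Equiv.Perm (E × Bool) where
  toFun d := (d.1, !d.2)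
  invFun d := (d.1, !d.2)
  left_inv d := by simp
  right_inv d := by simp

/-- The vertex that a dart leaves. -/
def tail (d : E × Bool) : V := if d.2 then G.src d.1 else G.tgt d.1

/-- The vertex that a dart reaches. -/
def head (d : E × Bool) : V := G.tail (rev d)

/-- Every vertex has exactly two incoming and exactly two outgoing edges. -/
def IsTwoTwoRegular : Prop :=
  ∀ v : V, Nat.card {e : E // G.tgt e = v} = 2 ∧ Nat.card {e : E // G.src e = v} = 2

/-- `G.IsWalk u l v`: the darts in `l` form a walk from `u` to `v` in the underlying undirected
graph. -/
def IsWalk : V → List (E × Bool) → V → Prop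
  | u, [], v => u = v
  | u, d :: l, v => G.tail d = u ∧ IsWalk (G.head d) l v

/-- The underlying undirected graph is nonempty and connected. -/
def IsConnected : Prop :=
  Nonempty V ∧ ∀ u v : V, ∃ l : List (E × Bool), G.IsWalk u l v

/-- Face tracing: after traversing `d`, continue along the edge that follows clockwise around the
vertex just reached. -/
def faceStep : Equiv.Perm (E × Bool) := rev.trans G.rot

/-- The faces of the cellular embedding: the orbits of face tracing. -/
def Face : Type _ := Quotient (Equiv.Perm.SameCycle.setoid G.faceStep)

/-- The face traced out by a dart. -/
def faceOf (d : E × Bool) : G.Face := Quotient.mk (Equiv.Perm.SameCycle.setoid G.faceStep) d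

/-- The facial walk once around the face of `d`, starting with `d`. -/
noncomputable def facialWalk (d : E × Bool) : List (E × Bool) :=
  List.iterate G.faceStep d (Function.minimalPeriod G.faceStep d)

/-- The rotation system describes a cellular embedding in the torus: the graph is connected (so that
the rotation system describes a cellular embedding in a connected closed orientable surface) and the
Euler characteristic of this surface is `0`. -/
def IsToroidal : Prop :=
  G.IsConnected ∧ (Nat.card V : ℤ) - (Nat.card E : ℤ) + (Nat.card G.Face : ℤ) = 0

/-- The elementary homotopies: insert a spur (an edge traversed back and forth), or insert a facial
walk, that is, push the walk across a face. -/
inductive ElementaryMove : List (E × Bool) → List (E × Bool) → Prop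
  | spur (p q : List (E × Bool)) (d : E × Bool) :
      ElementaryMove (p ++ q) (p ++ [d, rev d] ++ q)
  | face (p q : List (E × Bool)) (d : E × Bool) :
      ElementaryMove (p ++ q) (p ++ G.facialWalk d ++ q)

/-- Homotopy in the surface, with fixed ends, of walks from `u` to `v`: the equivalence relation on
these walks generated by the elementary homotopies. -/
def Homotopic (u v : V) : List (E × Bool) → List (E × Bool) → Prop :=
  Relation.EqvGen fun l l' => G.IsWalk u l v ∧ G.IsWalk u l' v ∧ G.ElementaryMove l l'

/-- A closed walk is contractible if it is homotopic to the constant walk. -/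
def Contractible (l : List (E × Bool)) : Prop :=
  ∃ v : V, G.IsWalk v l v ∧ G.Homotopic v v l []

/-- Traverse the listed edges one after the other, each in its own direction. -/
def along (c : List E) : List (E × Bool) := c.map fun e => (e, true)

/-- A directed circuit: a nonempty closed directed walk without repeated edges; vertices may be
repeated. -/
def IsDirectedCircuit (c : List E) : Prop :=
  c ≠ [] ∧ c.Nodup ∧ ∃ v : V, G.IsWalk v (along c) v

/-- The face `f` is bounded by the directed circuit `c`: the facial walk of `f`, started at a suitable
dart, is `c` or is `c` traversed backwards. -/
def Bounds (c : List E) (f : G.Face) : Prop :=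
  G.IsDirectedCircuit c ∧ ∃ d : E × Bool, G.faceOf d = f ∧
    (G.facialWalk d = along c ∨ G.facialWalk d = ((along c).map rev).reverse)

/-- All directed circuits are non-contractible. -/
def AllCircuitsNoncontractible : Prop :=
  ∀ c : List E, G.IsDirectedCircuit c → ¬ G.Contractible (along c)

/-- `a` lists, for every vertex, the four edge ends at this vertex in clockwise order (starting with
any one of them). -/
def IsRotationTable {n : ℕ} (G : RotationDigraph (Fin n) E) (a : Fin n → Fin 4 → E × Bool) : Prop :=
  ∀ v i, G.tail (a v i) = v ∧ G.rot (a v i) = a v (i + 1)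

end RotationDigraph

/-- The instructions of a random access machine with registers `reg` and memory `mem`, both holding
natural numbers. -/
inductive RAMInstr
  /-- `reg r := k` -/
  | const (r k : ℕ)
  /-- `reg r := reg s + reg t` -/
  | add (r s t : ℕ)
  /-- `reg r := max (reg s - reg t) 0` -/
  | sub (r s t : ℕ)
  /-- `reg r := mem (reg s)` -/
  | load (r s : ℕ)
  /-- `mem (reg r) := reg s` -/
  | store (r s : ℕ)
  /-- go to instruction number `l` if `reg r = 0` -/
  | jumpZero (r l : ℕ)

structure RAMState where
  pc : ℕ
  reg : ℕ → ℕ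
  mem : ℕ → ℕ

namespace RAMState

/-- The effect of one instruction. -/
def exec (s : RAMState) : RAMInstr → RAMState
  | .const r k => ⟨s.pc + 1, Function.update s.reg r k, s.mem⟩
  | .add r x y => ⟨s.pc + 1, Function.update s.reg r (s.reg x + s.reg y), s.mem⟩
  | .sub r x y => ⟨s.pc + 1, Function.update s.reg r (s.reg x - s.reg y), s.mem⟩
  | .load r x => ⟨s.pc + 1, Function.update s.reg r (s.mem (s.reg x)), s.mem⟩
  | .store r x => ⟨s.pc + 1, s.reg, Function.update s.mem (s.reg r) (s.reg x)⟩
  | .jumpZero r l => ⟨if s.reg r = 0 then l else s.pc + 1, s.reg, s.mem⟩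

/-- The machine halts when the program counter leaves the program. -/
def Halted (P : List RAMInstr) (s : RAMState) : Prop := P.length ≤ s.pc

/-- One step of the program `P`; a halted machine does not change any more. -/
def step (P : List RAMInstr) (s : RAMState) : RAMState :=
  match P[s.pc]? with
  | some i => s.exec i
  | none => s

/-- The state after `t` steps. -/
def run (P : List RAMInstr) (s : RAMState) (t : ℕ) : RAMState := (step P)^[t] s

/-- The initial state with memory contents `x 0, x 1, …`, followed by zeros. -/
def init (x : List ℕ) : RAMState := ⟨0, fun _ => 0, fun k => x.getD k 0⟩

/-- Started on the input `x`, the program `P` halts after at most `T` steps with `out` in register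
`0`, and until then no register and no memory cell ever holds a number greater than `B`. -/
def Computes (P : List RAMInstr) (x : List ℕ) (out T B : ℕ) : Prop :=
  ∃ t ≤ T, (run P (init x) t).Halted P ∧ (run P (init x) t).reg 0 = out ∧
    ∀ i ≤ t, ∀ k, (run P (init x) i).reg k ≤ B ∧ (run P (init x) i).mem k ≤ B

end RAMState

/-- The number of an edge end among the `2 * m` edge ends of a digraph with edges `0, …, m - 1`: the
outgoing end of `e` has number `e` and its incoming end has number `m + e`. -/
def dartCode {m : ℕ} (d : Fin m × Bool) : ℕ := if d.2 then (d.1 : ℕ) else m + d.1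

/-- The machine's input for a rotation table: the number `n` of vertices, followed, vertex by vertex,
by the numbers of the four edge ends at the vertex in clockwise order. -/
def encodeRotationTable {n m : ℕ} (a : Fin n → Fin 4 → Fin m × Bool) : List ℕ :=
  n :: (List.ofFn fun v => List.ofFn fun i => dartCode (a v i)).flatten

/-!
A directed closed walk `c` that is contractible lifts to a closed walk in the universal cover of the
surface. It may be replaced by a directed cycle without repeated vertices. Such a cycle has two
sides, one of which is a finite disc; choose the cycle so that the disc has as few darts as
possible. If both sides of some edge lay in the disc, then, because at each vertex as many edges
leave as enter, this edge could be continued within the disc, forwards and backwards, to a directed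
cycle, which would bound a smaller disc. So the disc is a single face bounded by a directed walk,
and the face of `G` below it is bounded by a directed circuit.

The topology is replaced by algebra. The cover has the vertices `G.EdgeGroup × V`, where
`G.EdgeGroup` is generated by the edges with the facial walks as relators (`RotationDigraph.cover`).
It is simply connected in the sense that every closed walk is the boundary of a finitely supported
integer function on the faces: the monodromy that records the `1`-chain of a lifted walk modulo
boundaries respects the relators (`RotationDigraph.acyclic_cover`). A cycle without repeated
vertices is the boundary of a function that takes exactly one value on each of its two sides
(`BalancedMap.IsCycle.const_sides`), and a function that jumps only inside one side is constant on
the other one (`BalancedMap.IsSide.const_compl`). This is all that is needed of the Jordan curve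
theorem, and it makes the descent `BalancedMap.IsSide.exists_ssubset` work.

For the last part it remains to decide whether some orbit of face tracing has darts of one direction
only. The program `faceProgram` tabulates the rotation and follows each orbit once, marking the
darts. Its bounds on numbers come from bounds at the heads of its two loops, since one step at most
doubles the largest number (`RAMState.Bounded.reaches`).
-/

/-! ### Balanced directed maps -/

/-- A balanced directed graph drawn on a surface, given by its darts `D` and vertices `W`: `inv`
reverses a dart, `rot` turns to the next dart around its tail, `fwd` tells the darts that run along
their edge from those that run against it. Finiteness is required only in the sense that iterating
`rot` reaches every dart with the same tail. The injection `swap` matches outgoing with incoming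
edge ends at each vertex. -/
structure BalancedMap (D W : Type*) where
  inv : D → D
  inv_inv : ∀ d, inv (inv d) = d
  rot : D → D
  tail : D → W
  tail_rot : ∀ d, tail (rot d) = tail d
  exists_rot : ∀ d d', tail d = tail d' → ∃ k : ℕ, rot^[k] d = d'
  fwd : D → Bool
  fwd_inv : ∀ d, fwd (inv d) = !fwd d
  swap : D → D
  swap_injective : Function.Injective swap
  tail_swap : ∀ d, tail (swap d) = tail d
  fwd_swap : ∀ d, fwd (swap d) = !fwd d

namespace BalancedMap

variable {D W : Type*} (M : BalancedMap D W)

/-- The vertex that a dart reaches. -/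
def head (d : D) : W := M.tail (M.inv d)

/-- Face tracing. -/
def next (d : D) : D := M.rot (M.inv d)

/-- `M.IsPath u l v`: the darts in `l` form a walk from `u` to `v`. -/
def IsPath : W → List D → W → Prop
  | u, [], v => u = v
  | u, d :: l, v => M.tail d = u ∧ IsPath (M.head d) l v

/-- The darts in `c` form a directed closed walk that repeats no vertex. -/
structure IsCycle (c : List D) : Prop where
  ne_nil : c ≠ []
  isPath : ∃ u, M.IsPath u c u
  nodup : (c.map M.tail).Nodup
  fwd : ∀ x ∈ c, M.fwd x = true

open Classical in
/-- The net number of times that a list of darts traverses the edge of `x` in the direction of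
`x`. -/
noncomputable def flux (l : List D) (x : D) : ℤ := l.count x - l.count (M.inv x)

/-- The function `φ` on the darts is a finitely supported `2`-chain (a function of the face to the
left of a dart), and its boundary is the `1`-chain of `l`. -/
structure Bounds (φ : D → ℤ) (l : List D) : Prop where
  finite : φ.support.Finite
  next : ∀ x, φ (M.next x) = φ x
  flux : ∀ x, M.flux l x = φ x - φ (M.inv x)

/-- Every directed closed walk is the boundary of a `2`-chain. -/
def Acyclic : Prop :=
  ∀ u l, l ≠ [] → M.IsPath u l u → (∀ x ∈ l, M.fwd x = true) → ∃ φ, M.Bounds φ l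

/-- `y` lies in the component of `x`. -/
def Conn (x y : D) : Prop := Relation.ReflTransGen (fun a b => b = M.inv a ∨ b = M.rot a) x y

variable {M}

lemma next_inv (d : D) : M.next (M.inv d) = M.rot d := by rw [next, M.inv_inv]

lemma tail_next (d : D) : M.tail (M.next d) = M.head d := M.tail_rot _

lemma head_inv (d : D) : M.head (M.inv d) = M.tail d := by rw [head, M.inv_inv]

lemma inv_injective : Function.Injective M.inv :=
  Function.LeftInverse.injective M.inv_inv

lemma Conn.inv {x y : D} (h : M.Conn x y) : M.Conn x (M.inv y) := h.tail (Or.inl rfl)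

lemma Conn.rot {x y : D} (h : M.Conn x y) : M.Conn x (M.rot y) := h.tail (Or.inr rfl)

lemma Conn.of_inv {x y : D} (h : M.Conn x (M.inv y)) : M.Conn x y := by
  simpa [M.inv_inv] using h.inv

lemma Conn.of_tail_eq {x y z : D} (h : M.Conn x y) (hz : M.tail y = M.tail z) : M.Conn x z := by
  obtain ⟨k, rfl⟩ := M.exists_rot _ _ hz
  clear hz
  induction k with
  | zero => exact h
  | succ k ih => rw [Function.iterate_succ_apply']; exact ih.rot

lemma Conn.next_iff {x y : D} : M.Conn x (M.next y) ↔ M.Conn x y :=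
  ⟨fun h => (h.of_tail_eq (tail_next y)).of_inv, fun h => h.inv.rot⟩

lemma IsPath.of_append {u w : W} {l l' : List D} (h : M.IsPath u (l ++ l') w) :
    ∃ v, M.IsPath u l v ∧ M.IsPath v l' w := by
  induction l generalizing u with
  | nil => exact ⟨u, rfl, h⟩
  | cons d l ih =>
    obtain ⟨v, h1, h2⟩ := ih h.2
    exact ⟨v, ⟨h.1, h1⟩, h2⟩

lemma IsPath.cons_map_head {u v : W} {l : List D} (h : M.IsPath u l v) :
    u :: l.map M.head = l.map M.tail ++ [v] := by
  induction l generalizing u with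
  | nil => cases h; rfl
  | cons d l ih => simp [h.1, ih h.2]

namespace IsCycle

variable {c : List D}

lemma map_head_perm (h : M.IsCycle c) : (c.map M.head).Perm (c.map M.tail) := by
  obtain ⟨u, hu⟩ := h.isPath
  have h1 : (u :: c.map M.head).Perm (u :: c.map M.tail) := by
    rw [hu.cons_map_head]
    exact List.perm_append_singleton _ _
  exact h1.cons_inv

lemma eq_of_tail {x y : D} (h : M.IsCycle c) (hx : x ∈ c) (hy : y ∈ c)
    (hxy : M.tail x = M.tail y) : x = y :=
  List.inj_on_of_nodup_map h.nodup hx hy hxy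

lemma eq_of_head {x y : D} (h : M.IsCycle c) (hx : x ∈ c) (hy : y ∈ c)
    (hxy : M.head x = M.head y) : x = y :=
  List.inj_on_of_nodup_map (h.map_head_perm.nodup_iff.2 h.nodup) hx hy hxy

lemma exists_tail_eq_head {x : D} (h : M.IsCycle c) (hx : x ∈ c) :
    ∃ y ∈ c, M.tail y = M.head x := by
  have := h.map_head_perm.mem_iff.1 (List.mem_map_of_mem hx)
  simpa using this

lemma inv_notMem {x : D} (h : M.IsCycle c) (hx : x ∈ c) : M.inv x ∉ c := fun hx' => by
  have h1 := h.fwd _ hx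
  have h2 := h.fwd _ hx'
  rw [M.fwd_inv, h1] at h2
  exact absurd h2 (by simp)

lemma flux_of_mem {x : D} (h : M.IsCycle c) (hx : x ∈ c) : M.flux c x = 1 := by
  classical
  rw [flux, List.count_eq_one_of_mem (h.nodup.of_map _) hx,
    List.count_eq_zero_of_not_mem (h.inv_notMem hx)]
  rfl

end IsCycle

lemma flux_of_notMem {l : List D} {x : D} (hx : x ∉ l) (hx' : M.inv x ∉ l) :
    M.flux l x = 0 := by
  classical
  rw [flux, List.count_eq_zero_of_not_mem hx, List.count_eq_zero_of_not_mem hx']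
  rfl

/-- A function of the faces does not change when the corners from `x` clockwise to `y` are swept
without crossing an edge on which it jumps. -/
lemma eq_of_sweep {β : Type*} {ψ : D → β} (hψ : ∀ d, ψ (M.next d) = ψ d) {x y : D}
    (hxy : x ≠ y) (ht : M.tail x = M.tail y)
    (h : ∀ d, M.tail d = M.tail y → d ≠ x → d ≠ y → ψ (M.inv d) = ψ d) :
    ψ y = ψ (M.inv x) := by
  classical
  have hex := M.exists_rot x y ht
  set k := Nat.find hex with hk
  have hky : M.rot^[k] x = y := Nat.find_spec hex
  have hmin : ∀ j < k, M.rot^[j] x ≠ y := fun j hj => Nat.find_min hex hj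
  have htail : ∀ j, M.tail (M.rot^[j] x) = M.tail y := by
    intro j
    induction j with
    | zero => exact ht
    | succ j ih => rw [Function.iterate_succ_apply', M.tail_rot, ih]
  have key : ∀ j, j + 1 ≤ k → ψ (M.rot^[j + 1] x) = ψ (M.inv x) := by
    intro j
    induction j with
    | zero => intro _; rw [← hψ (M.inv x), next_inv]; rfl
    | succ j ih =>
      intro hj
      rw [Function.iterate_succ_apply', ← next_inv, hψ, h _ (htail _) _ (hmin _ (by omega))]
      · exact ih (by omega)
      · intro hx
        -- returning to `x` before `y` would give a shorter way to `y`
        apply hmin (k - (j + 1)) (by omega)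
        conv_lhs => rw [← hx]
        rw [← Function.iterate_add_apply, show k - (j + 1) + (j + 1) = k by omega, hky]
  have hk0 : k ≠ 0 := by
    intro h0
    rw [h0] at hky
    exact hxy hky
  obtain ⟨j, hj⟩ := Nat.exists_eq_succ_of_ne_zero hk0
  rw [← hky, hj]
  exact key j (by omega)

section Cycle

variable {c : List D} {β : Type*} {ψ : D → β}

/-- A function of the faces that jumps only across the edges of a cycle takes a single value on the
left side of the cycle and a single value on its right side. -/
lemma IsCycle.const_sides (h : M.IsCycle c) (hψ : ∀ d, ψ (M.next d) = ψ d)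
    (hc : ∀ d, d ∉ c → M.inv d ∉ c → ψ (M.inv d) = ψ d) {x y : D} (hx : x ∈ c) (hy : y ∈ c) :
    ψ y = ψ x ∧ ψ (M.inv y) = ψ (M.inv x) := by
  have step : ∀ x ∈ c, ∀ y ∈ c, M.tail y = M.head x →
      ψ y = ψ x ∧ ψ (M.inv y) = ψ (M.inv x) := by
    intro x hx y hy hxy
    have hne : M.inv x ≠ y := fun hh => h.inv_notMem hx (hh ▸ hy)
    have hother : ∀ d, M.tail d = M.tail y → d ≠ M.inv x → d ≠ y → ψ (M.inv d) = ψ d := by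
      intro d hd hdx hdy
      refine hc d (fun hdc => hdy (h.eq_of_tail hdc hy hd)) fun hdc => hdx ?_
      have h1 := h.eq_of_head hdc hx (by rw [head_inv, hd, hxy])
      rw [← h1, M.inv_inv]
    constructor
    · have := eq_of_sweep hψ hne hxy.symm hother
      rwa [M.inv_inv] at this
    · refine (eq_of_sweep hψ hne.symm hxy fun d hd h1 h2 => hother d ?_ h2 h1).symm
      rw [hd, hxy]; rfl
  -- walk around the cycle, starting from its first dart
  have walk : ∀ (l : List D) (z : D), z ∈ c → (∀ a ∈ l, a ∈ c) → ∀ v, M.IsPath (M.head z) l v →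
      ∀ a ∈ l, ψ a = ψ z ∧ ψ (M.inv a) = ψ (M.inv z) := by
    intro l
    induction l with
    | nil => simp
    | cons b l ih =>
      intro z hz hl v hp a ha
      have hb : b ∈ c := hl b (by simp)
      have h1 := step z hz b hb hp.1
      rcases List.mem_cons.1 ha with rfl | ha
      · exact h1
      · have h2 := ih b hb (fun a ha => hl a (by simp [ha])) v hp.2 a ha
        exact ⟨h2.1.trans h1.1, h2.2.trans h1.2⟩
  obtain ⟨u, hu⟩ := h.isPath
  obtain ⟨e, l, rfl⟩ := List.exists_cons_of_ne_nil h.ne_nil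
  have all : ∀ a ∈ e :: l, ψ a = ψ e ∧ ψ (M.inv a) = ψ (M.inv e) := by
    intro a ha
    rcases List.mem_cons.1 ha with rfl | ha
    · exact ⟨rfl, rfl⟩
    · exact walk l e (by simp) (fun a ha => by simp [ha]) u hu.2 a ha
  exact ⟨(all y hy).1.trans (all x hx).1.symm, (all y hy).2.trans (all x hx).2.symm⟩

end Cycle

/-! ### Sides of a cycle -/

/-- The set `S` of darts is one side of the cycle `c`: it consists of the darts of some faces in the
component of `c`, crossing an edge leads from `S` to its complement exactly at the edges of `c`, and
`S` lies either to the left of all the darts of `c` or to the right of all of them. -/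
structure IsSide (M : BalancedMap D W) (c : List D) (S : Set D) : Prop where
  next_mem : ∀ x, M.next x ∈ S ↔ x ∈ S
  inv_mem : ∀ x, x ∉ c → M.inv x ∉ c → (M.inv x ∈ S ↔ x ∈ S)
  left_or_right : (∀ x ∈ c, x ∈ S ∧ M.inv x ∉ S) ∨ (∀ x ∈ c, x ∉ S ∧ M.inv x ∈ S)
  conn : ∀ z ∈ c, ∀ x ∈ S, M.Conn z x

lemma IsCycle.conn {c : List D} (h : M.IsCycle c) {x y : D} (hx : x ∈ c) (hy : y ∈ c) :
    M.Conn x y := by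
  have := (h.const_sides (ψ := fun d => M.Conn x d)
    (fun d => propext Conn.next_iff)
    (fun d _ _ => propext ⟨fun h => h.of_inv, fun h => h.inv⟩) hx hy).1
  rw [this]
  exact Relation.ReflTransGen.refl

/-- Since the `2`-chain that a cycle bounds takes different values on its two sides, one of the
sides avoids any given value. -/
lemma IsCycle.exists_isSide {c : List D} (h : M.IsCycle c) {φ : D → ℤ} (hφ : M.Bounds φ c)
    (b : ℤ) : ∃ S, IsSide M c S ∧ ∀ x ∈ S, φ x ≠ b := by
  obtain ⟨e, he⟩ := List.exists_mem_of_ne_nil c h.ne_nil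
  have hflat : ∀ d, d ∉ c → M.inv d ∉ c → φ (M.inv d) = φ d := by
    intro d h1 h2
    have := hφ.flux d
    rw [flux_of_notMem h1 h2] at this
    omega
  have hcs := fun x (hx : x ∈ c) => h.const_sides hφ.next hflat he hx
  have hjump : φ e = φ (M.inv e) + 1 := by
    have := hφ.flux e
    rw [h.flux_of_mem he] at this
    omega
  have main : ∀ s, (s = e ∨ s = M.inv e) → IsSide M c {x | M.Conn e x ∧ φ x = φ s} := by
    intro s hs
    refine ⟨fun x => ?_, fun x h1 h2 => ?_, ?_, fun z hz x hx => (h.conn hz he).trans hx.1⟩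
    · simp [Conn.next_iff, hφ.next]
    · simp only [Set.mem_ofPred_eq, hflat x h1 h2]
      exact and_congr_left fun _ => ⟨fun h => h.of_inv, fun h => h.inv⟩
    · rcases hs with rfl | rfl
      · refine Or.inl fun x hx => ⟨⟨h.conn he hx, (hcs x hx).1⟩, fun hh => ?_⟩
        have h1 := hh.2
        rw [(hcs x hx).2] at h1
        omega
      · refine Or.inr fun x hx => ⟨fun hh => ?_, ⟨(h.conn he hx).inv, (hcs x hx).2⟩⟩
        have h1 := hh.2
        rw [(hcs x hx).1] at h1
        omega
  by_cases hb : φ e = b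
  · refine ⟨_, main (M.inv e) (Or.inr rfl), fun x hx => ?_⟩
    rw [hx.2]
    omega
  · refine ⟨_, main e (Or.inl rfl), fun x hx => ?_⟩
    rwa [hx.2]

/-- The complement of a side of a cycle is connected: a function of the faces that does not jump
across the edges outside `S` is constant there. -/
lemma IsSide.const_compl {c : List D} {S : Set D} (h : M.IsCycle c) (hS : IsSide M c S)
    {ψ : D → ℤ} (hψ : ∀ d, ψ (M.next d) = ψ d)
    (hflat : ∀ x, x ∉ S → M.inv x ∉ S → ψ (M.inv x) = ψ x) {z : D} (hz : z ∈ c) :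
    ∃ b, ∀ x, M.Conn z x → x ∉ S → ψ x = b := by
  classical
  let χ : D → Option ℤ := fun x => if x ∈ S then none else some (ψ x)
  have hχ : ∀ d, χ (M.next d) = χ d := by
    intro d
    simp only [χ, hψ, hS.next_mem]
  have hχflat : ∀ d, d ∉ c → M.inv d ∉ c → χ (M.inv d) = χ d := by
    intro d h1 h2
    have h3 := hS.inv_mem d h1 h2
    by_cases hd : d ∈ S
    · simp [χ, hd, h3.2 hd]
    · have hd' : M.inv d ∉ S := fun h => hd (h3.1 h)
      simp [χ, hd, hd', hflat d hd hd']
  have hcs := fun x (hx : x ∈ c) => h.const_sides hχ hχflat hz hx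
  obtain ⟨w, hw, hwS⟩ : ∃ w, (w = z ∨ w = M.inv z) ∧ w ∉ S := by
    rcases hS.left_or_right with h1 | h1
    · exact ⟨_, Or.inr rfl, (h1 z hz).2⟩
    · exact ⟨_, Or.inl rfl, (h1 z hz).1⟩
  have hnear : ∀ x, (x ∈ c ∨ M.inv x ∈ c) → x ∉ S → χ x = χ w := by
    intro x hx hxS
    have hnone : ∀ y, y ∈ S → χ y = none := fun y hy => by simp [χ, hy]
    have hsome : ∀ y, y ∉ S → χ y ≠ none := fun y hy => by simp [χ, hy]
    rcases hx with hx | hx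
    · have h1 := (hcs x hx).1
      rcases hw with rfl | rfl
      · exact h1
      · rcases hS.left_or_right with h2 | h2
        · exact absurd (h2 x hx).1 hxS
        · exact absurd (h2 z hz).2 hwS
    · have h1 := (hcs _ hx).2
      rw [M.inv_inv] at h1
      rcases hw with rfl | rfl
      · rcases hS.left_or_right with h2 | h2
        · exact absurd (h2 w hz).1 hwS
        · exact absurd (M.inv_inv x ▸ (h2 _ hx).2) hxS
      · exact h1
  have hall : ∀ x, M.Conn z x → (x ∈ S ∨ χ x = χ w) := by
    have hinv : ∀ x, (x ∈ S ∨ χ x = χ w) → (M.inv x ∈ S ∨ χ (M.inv x) = χ w) := by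
      intro x hx
      by_cases hxc : x ∈ c ∨ M.inv x ∈ c
      · by_cases hxS : M.inv x ∈ S
        · exact Or.inl hxS
        · refine Or.inr (hnear _ ?_ hxS)
          rw [M.inv_inv]
          exact hxc.symm
      · push Not at hxc
        rw [hS.inv_mem x hxc.1 hxc.2, hχflat x hxc.1 hxc.2]
        exact hx
    intro x hx
    induction hx with
    | refl =>
      by_cases hzS : z ∈ S
      · exact Or.inl hzS
      · exact Or.inr (hnear z (Or.inl hz) hzS)
    | tail _ hxy ih =>
      rcases hxy with rfl | rfl
      · exact hinv _ ih
      · rw [← next_inv, hS.next_mem, hχ]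
        exact hinv _ ih
  refine ⟨ψ w, fun x hx hxS => ?_⟩
  have := (hall x hx).resolve_left hxS
  simpa [χ, hxS, hwS] using this

/-! ### Cycles through a given edge -/

/-- There is a walk from `u` to `v` along darts that satisfy `H`. -/
def Reach (M : BalancedMap D W) (H : D → Prop) (u v : W) : Prop :=
  Relation.ReflTransGen (fun a b => ∃ x, H x ∧ M.tail x = a ∧ M.head x = b) u v

lemma Reach.exists_path {H : D → Prop} {u v : W} (h : Reach M H u v) :
    ∃ l, M.IsPath u l v ∧ (∀ x ∈ l, H x) ∧ (l.map M.tail).Nodup ∧ v ∉ l.map M.tail := by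
  induction h using Relation.ReflTransGen.head_induction_on with
  | refl => exact ⟨[], rfl, by simp, by simp, by simp⟩
  | @head u w huw _ ih =>
    obtain ⟨x, hx, rfl, rfl⟩ := huw
    obtain ⟨l, hl, hH, hnd, hv⟩ := ih
    by_cases hxv : M.tail x = v
    · exact ⟨[], hxv, by simp, by simp, by simp⟩
    by_cases hxl : M.tail x ∈ l.map M.tail
    · -- shortcut: leave out the closed walk from the tail of `x` to itself
      obtain ⟨y, hy, hyx⟩ := List.mem_map.1 hxl
      obtain ⟨l1, l2, rfl⟩ := List.append_of_mem hy
      obtain ⟨w, _, h2⟩ := hl.of_append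
      refine ⟨y :: l2, ⟨hyx, h2.2⟩, fun a ha => hH a (List.mem_append_right _ ha), ?_, ?_⟩
      · rw [List.map_append] at hnd
        exact hnd.of_append_right
      · rw [List.map_append] at hv
        exact fun h => hv (List.mem_append_right _ h)
    · refine ⟨x :: l, ⟨rfl, hl⟩, ?_, ?_, ?_⟩
      · simpa [hx] using hH
      · rw [List.map_cons]
        exact List.nodup_cons.2 ⟨hxl, hnd⟩
      · rw [List.map_cons, List.mem_cons]
        rintro (h | h)
        · exact hxv h.symm
        · exact hv h

lemma Reach.of_isPath {H : D → Prop} {u v : W} {l : List D} (h : M.IsPath u l v)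
    (hH : ∀ x ∈ l, H x) : Reach M H u v := by
  induction l generalizing u with
  | nil => cases h; exact Relation.ReflTransGen.refl
  | cons d l ih =>
    exact Relation.ReflTransGen.head ⟨d, hH d (by simp), h.1, rfl⟩
      (ih h.2 fun x hx => hH x (by simp [hx]))

lemma Reach.exists_isCycle {H : D → Prop} (hH : ∀ x, H x → M.fwd x = true) {e : D} (he : H e)
    (h : Reach M H (M.head e) (M.tail e)) :
    ∃ c, M.IsCycle c ∧ e ∈ c ∧ ∀ x ∈ c, H x := by
  obtain ⟨l, hl, hlH, hnd, hv⟩ := h.exists_path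
  have hc : ∀ x ∈ e :: l, H x := by simpa [he] using hlH
  exact ⟨e :: l, ⟨by simp, ⟨_, rfl, hl⟩, by
    rw [List.map_cons]; exact List.nodup_cons.2 ⟨hv, hnd⟩, fun x hx => hH x (hc x hx)⟩,
    by simp, hc⟩

lemma IsCycle.reach {c : List D} (h : M.IsCycle c) {H : D → Prop} (hH : ∀ x ∈ c, H x) {x y : D}
    (hx : x ∈ c) (hy : y ∈ c) : Reach M H (M.tail x) (M.tail y) := by
  obtain ⟨u, hu⟩ := h.isPath
  have h1 : ∀ a ∈ c, Reach M H u (M.tail a) ∧ Reach M H (M.tail a) u := by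
    intro a ha
    obtain ⟨l1, l2, rfl⟩ := List.append_of_mem ha
    obtain ⟨w, h1, h2⟩ := hu.of_append
    rw [h2.1]
    exact ⟨.of_isPath h1 fun b hb => hH b (by simp [hb]),
      .of_isPath h2 fun b hb => hH b (List.mem_append_right _ hb)⟩
  exact (h1 x hx).2.trans (h1 y hy).1

/-- Euler's balance argument: if no edge leaves a finite set of vertices, then none enters it (and
conversely). -/
lemma head_mem_of_closed {T : Set W} {b : Bool}
    (hfin : {d | M.tail d ∈ T ∧ M.fwd d = !b}.Finite)
    (hT : ∀ d, M.tail d ∈ T → M.fwd d = b → M.head d ∈ T) {d : D} (hd : M.tail d ∈ T)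
    (hb : M.fwd d = !b) : M.head d ∈ T := by
  have hmaps : Set.MapsTo (fun d => M.inv (M.swap d)) {d | M.tail d ∈ T ∧ M.fwd d = !b}
      {d | M.tail d ∈ T ∧ M.fwd d = !b} := by
    rintro x ⟨h1, h2⟩
    have h3 : M.fwd (M.swap x) = b := by rw [M.fwd_swap, h2, Bool.not_not]
    exact ⟨hT _ (by rwa [M.tail_swap]) h3, by rw [M.fwd_inv, h3]⟩
  have hinj : Function.Injective fun d => M.inv (M.swap d) := inv_injective.comp M.swap_injective
  have hsurj := ((hfin.injOn_iff_bijOn_of_mapsTo hmaps).1 hinj.injOn).surjOn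
  obtain ⟨x, hx, rfl⟩ := hsurj ⟨hd, hb⟩
  simp only [head_inv, M.tail_swap]
  exact hx.1

section Side

variable {c : List D} {S : Set D}

lemma IsSide.mem_of_tail_eq (h : M.IsCycle c) (hS : IsSide M c S) {s d : D} (hs : s ∈ S)
    (hc : ∀ x ∈ c, M.tail x ≠ M.tail s) (hd : M.tail s = M.tail d) : d ∈ S := by
  obtain ⟨k, rfl⟩ := M.exists_rot _ _ hd
  have htail : ∀ j, M.tail (M.rot^[j] s) = M.tail s := by
    intro j
    induction j with
    | zero => rfl
    | succ j ih => rw [Function.iterate_succ_apply', M.tail_rot, ih]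
  clear hd
  induction k with
  | zero => exact hs
  | succ k ih =>
    rw [Function.iterate_succ_apply', ← next_inv, hS.next_mem, hS.inv_mem]
    · exact ih
    · exact fun hx => hc _ hx (htail k)
    · intro hx
      obtain ⟨y, hy, hyx⟩ := h.exists_tail_eq_head hx
      rw [head_inv, htail] at hyx
      exact hc y hy hyx

/-- Through every edge inside a finite side of a cycle there is a cycle that stays in the closure of
this side. The vertices that can be reached from the end of the edge within the closure either
include its start, by Euler's balance argument, or reach the cycle; the same holds backwards. -/
lemma IsSide.exists_isCycle (h : M.IsCycle c) (hS : IsSide M c S) (hfin : S.Finite) {e : D}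
    (he : e ∈ S) (he' : M.inv e ∈ S) (hfwd : M.fwd e = true) :
    ∃ c', M.IsCycle c' ∧ e ∈ c' ∧ ∀ x ∈ c', x ∈ S ∨ M.inv x ∈ S := by
  let H : D → Prop := fun x => M.fwd x = true ∧ (x ∈ S ∨ M.inv x ∈ S)
  have hcH : ∀ x ∈ c, H x := fun x hx => ⟨h.fwd x hx, by
    rcases hS.left_or_right with h1 | h1
    · exact Or.inl (h1 x hx).1
    · exact Or.inr (h1 x hx).2⟩
  suffices hr : Reach M H (M.head e) (M.tail e) by
    obtain ⟨c', h1, h2, h3⟩ := hr.exists_isCycle (fun x hx => hx.1) ⟨hfwd, Or.inl he⟩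
    exact ⟨c', h1, h2, fun x hx => (h3 x hx).2⟩
  -- every vertex of the closure is the tail of a dart in `S`
  have htailH : ∀ x, H x → ∃ s ∈ S, M.tail s = M.tail x := by
    rintro x ⟨_, hx | hx⟩
    · exact ⟨x, hx, rfl⟩
    · exact ⟨M.next (M.inv x), (hS.next_mem _).2 hx, by rw [tail_next, head_inv]⟩
  have hheadH : ∀ x, H x → ∃ s ∈ S, M.tail s = M.head x := by
    rintro x ⟨_, hx | hx⟩
    · exact ⟨M.next x, (hS.next_mem _).2 hx, by rw [tail_next]⟩
    · exact ⟨M.inv x, hx, rfl⟩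
  have hin : ∀ T : Set W, (∀ w ∈ T, ∃ s ∈ S, M.tail s = w) →
      (∀ x ∈ c, M.tail x ∉ T) → ∀ d, M.tail d ∈ T → d ∈ S := by
    intro T hT hTc d hd
    obtain ⟨s, hs, hsd⟩ := hT _ hd
    exact hS.mem_of_tail_eq h hs (fun x hx hxs => hTc x hx (by rwa [hxs, hsd])) hsd
  by_cases hR : ∃ x ∈ c, Reach M H (M.head e) (M.tail x)
  · by_cases hB : ∃ x ∈ c, Reach M H (M.tail x) (M.tail e)
    · obtain ⟨x, hx, hex⟩ := hR
      obtain ⟨y, hy, hye⟩ := hB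
      exact (hex.trans (h.reach hcH hx hy)).trans hye
    · push Not at hB
      have hT := hin {w | Reach M H w (M.tail e)} (fun w hw => by
        rcases Relation.ReflTransGen.cases_head hw with rfl | ⟨w', ⟨x, hx, rfl, rfl⟩, _⟩
        · exact ⟨e, he, rfl⟩
        · exact htailH x hx) hB
      exact head_mem_of_closed (b := false) (hfin.subset fun d hd => hT d hd.1)
        (fun d hd hdf => Relation.ReflTransGen.head
          ⟨M.inv d, ⟨by rw [M.fwd_inv, hdf]; rfl, Or.inr (by rw [M.inv_inv]; exact hT d hd)⟩,
            rfl, head_inv d⟩ hd) (d := e) Relation.ReflTransGen.refl hfwd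
  · push Not at hR
    have hT := hin {w | Reach M H (M.head e) w} (fun w hw => by
      rcases Relation.ReflTransGen.cases_tail hw with rfl | ⟨w', _, ⟨x, hx, rfl, rfl⟩⟩
      · exact ⟨_, he', rfl⟩
      · exact hheadH x hx) hR
    have := head_mem_of_closed (b := true) (hfin.subset fun d hd => hT d hd.1)
      (fun d hd hdf => Relation.ReflTransGen.tail hd ⟨d, ⟨hdf, Or.inl (hT d hd)⟩, rfl, rfl⟩)
      (d := M.inv e) Relation.ReflTransGen.refl (by rw [M.fwd_inv, hfwd])
    rwa [head_inv] at this

/-- A finite side of a cycle that contains both sides of some edge is not minimal. -/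
lemma IsSide.exists_ssubset (hM : M.Acyclic) (h : M.IsCycle c) (hS : IsSide M c S)
    (hfin : S.Finite) {e : D} (he : e ∈ S) (he' : M.inv e ∈ S) :
    ∃ c' S', M.IsCycle c' ∧ IsSide M c' S' ∧ S' ⊂ S := by
  wlog hfwd : M.fwd e = true generalizing e
  · refine this he' (by rwa [M.inv_inv]) ?_
    rw [M.fwd_inv]
    simpa using hfwd
  obtain ⟨c', hc', hec', hcS⟩ := hS.exists_isCycle h hfin he he' hfwd
  obtain ⟨u, hu⟩ := hc'.isPath
  obtain ⟨ψ, hψ⟩ := hM u c' hc'.ne_nil hu hc'.fwd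
  obtain ⟨z, hz⟩ := List.exists_mem_of_ne_nil c h.ne_nil
  obtain ⟨b, hb⟩ := hS.const_compl h hψ.next (fun x h1 h2 => by
    have h3 := hψ.flux x
    rw [flux_of_notMem] at h3
    · omega
    · exact fun hx => (hcS x hx).elim h1 h2
    · exact fun hx => (hcS _ hx).elim h2 (by rwa [M.inv_inv])) hz
  obtain ⟨S', hS', hS'b⟩ := hc'.exists_isSide hψ b
  have hsub : S' ⊆ S := by
    intro x hx
    by_contra hxS
    exact hS'b x hx (hb x ((hS.conn z hz e he).trans (hS'.conn e hec' x hx)) hxS)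
  refine ⟨c', S', hc', hS', hsub, fun hSS => ?_⟩
  rcases hS'.left_or_right with h1 | h1
  · exact (h1 e hec').2 (hSS he')
  · exact (h1 e hec').1 (hSS he)

/-- If all closed directed walks bound and there is one, then some face is bounded by a directed
walk: a minimal finite side of a cycle is a single face. -/
theorem Acyclic.exists_monochromatic (hM : M.Acyclic) {u : W} {l : List D} (hl : l ≠ [])
    (hu : M.IsPath u l u) (hfwd : ∀ x ∈ l, M.fwd x = true) :
    ∃ d, ∀ k : ℕ, M.fwd (M.next^[k] d) = M.fwd d := by
  -- descend along proper subsets of finite sides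
  have descent : ∀ (n : ℕ) (c : List D) (S : Set D), M.IsCycle c → IsSide M c S → S.Finite →
      S.ncard = n → ∃ d, ∀ k : ℕ, M.fwd (M.next^[k] d) = M.fwd d := by
    intro n
    induction n using Nat.strong_induction_on with
    | _ n ih =>
      rintro c S hc hS hfin rfl
      by_cases hint : ∃ x ∈ S, M.inv x ∈ S
      · obtain ⟨e, he, he'⟩ := hint
        obtain ⟨c', S', hc', hS', hsub⟩ := hS.exists_ssubset hM hc hfin he he'
        exact ih _ (Set.ncard_lt_ncard hsub hfin) c' S' hc' hS' (hfin.subset hsub.1) rfl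
      · push Not at hint
        have hmem : ∀ x ∈ S, x ∈ c ∨ M.inv x ∈ c := by
          intro x hx
          by_contra hxc
          push Not at hxc
          exact hint x hx ((hS.inv_mem x hxc.1 hxc.2).2 hx)
        obtain ⟨z, hz⟩ := List.exists_mem_of_ne_nil c hc.ne_nil
        obtain ⟨b, d, hd, hb⟩ : ∃ b, ∃ d ∈ S, ∀ x ∈ S, M.fwd x = b := by
          rcases hS.left_or_right with h1 | h1
          · refine ⟨true, z, (h1 z hz).1, fun x hx => ?_⟩
            rcases hmem x hx with h2 | h2
            · exact hc.fwd x h2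
            · exact absurd (h1 _ h2).1 (hint x hx)
          · refine ⟨false, M.inv z, (h1 z hz).2, fun x hx => ?_⟩
            rcases hmem x hx with h2 | h2
            · exact absurd hx (h1 x h2).1
            · have := hc.fwd _ h2
              rw [M.fwd_inv] at this
              simpa using this
        have horb : ∀ k : ℕ, M.next^[k] d ∈ S := by
          intro k
          induction k with
          | zero => exact hd
          | succ k ihk => rw [Function.iterate_succ_apply', hS.next_mem]; exact ihk
        exact ⟨d, fun k => by rw [hb _ (horb k), hb _ hd]⟩
  obtain ⟨e, l, rfl⟩ := List.exists_cons_of_ne_nil hl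
  obtain ⟨c, hc, -⟩ := Reach.exists_isCycle (M := M) (H := fun x => M.fwd x = true)
    (fun _ h => h) (hfwd e (by simp))
    (hu.1 ▸ .of_isPath hu.2 fun x hx => hfwd x (by simp [hx]))
  obtain ⟨v, hv⟩ := hc.isPath
  obtain ⟨φ, hφ⟩ := hM v c hc.ne_nil hv hc.fwd
  obtain ⟨S, hS, hS0⟩ := hc.exists_isSide hφ 0
  exact descent _ c S hc hS (hφ.finite.subset fun x hx => hS0 x hx) rfl

end Side

end BalancedMap

/-! ### The universal cover -/

namespace BalancedMap

variable {D W : Type*} (M : BalancedMap D W)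

/-- The boundaries of finitely supported `2`-chains. -/
def boundaries : AddSubgroup (D → ℤ) where
  carrier := {h | ∃ φ : D → ℤ, φ.support.Finite ∧ (∀ x, φ (M.next x) = φ x) ∧
    ∀ x, h x = φ x - φ (M.inv x)}
  zero_mem' := ⟨0, by simp, by simp, by simp⟩
  add_mem' := by
    rintro a b ⟨φ, h1, h2, h3⟩ ⟨ψ, h4, h5, h6⟩
    refine ⟨φ + ψ, (h1.union h4).subset (Function.support_add φ ψ), fun x => ?_, fun x => ?_⟩
    · simp [h2, h5]
    · simp only [Pi.add_apply, h3, h6]; ring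
  neg_mem' := by
    rintro a ⟨φ, h1, h2, h3⟩
    refine ⟨-φ, by rwa [Function.support_neg], fun x => ?_, fun x => ?_⟩
    · simp [h2]
    · simp only [Pi.neg_apply, h3]; ring

variable {M}

lemma exists_bounds_iff {l : List D} : (∃ φ, M.Bounds φ l) ↔ M.flux l ∈ M.boundaries :=
  ⟨fun ⟨φ, h⟩ => ⟨φ, h.finite, h.next, h.flux⟩, fun ⟨φ, h1, h2, h3⟩ => ⟨φ, h1, h2, h3⟩⟩

lemma flux_nil : M.flux [] = 0 := by
  ext x; simp [flux]

lemma flux_cons (d : D) (l : List D) : M.flux (d :: l) = M.flux [d] + M.flux l := by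
  classical
  ext x
  simp only [flux, Pi.add_apply, List.count_cons, List.count_nil]
  push_cast
  ring

lemma flux_inv (d : D) : M.flux [M.inv d] = -M.flux [d] := by
  classical
  ext x
  have h1 : (M.inv d = M.inv x) ↔ d = x := inv_injective.eq_iff
  have h2 : (M.inv d = x) ↔ d = M.inv x := by
    rw [← inv_injective.eq_iff (a := d) (b := M.inv x) (f := M.inv), M.inv_inv]
  simp [flux, List.count_singleton, h1, h2]

/-- The facial walk of a finite face is the boundary of this face. -/
lemma flux_iterate_mem (hinj : Function.Injective M.next) {d : D} {k : ℕ}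
    (hk : M.next^[k] d = d) : M.flux (List.iterate M.next d k) ∈ M.boundaries := by
  classical
  refine ⟨fun x => (List.iterate M.next d k).count x, ?_, fun x => ?_, fun x => rfl⟩
  · refine (List.finite_toSet (List.iterate M.next d k)).subset fun x hx => ?_
    by_contra h
    exact hx (by simpa using List.count_eq_zero_of_not_mem h)
  · have hmap : ∀ (j : ℕ) (y : D),
        (List.iterate M.next y j).map M.next = List.iterate M.next (M.next y) j := by
      intro j
      induction j with
      | zero => intro y; rfl
      | succ j ih => intro y; simp [List.iterate, ih]
    have hperm : ((List.iterate M.next d k).map M.next).Perm (List.iterate M.next d k) := by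
      cases k with
      | zero => rfl
      | succ j =>
        rw [hmap, List.iterate_add, ← Function.iterate_succ_apply, hk]
        exact List.perm_append_singleton _ _
    change ((List.count _ _ : ℕ) : ℤ) = (List.count _ _ : ℕ)
    rw [← hperm.count_eq, List.count_map_of_injective _ _ hinj]

end BalancedMap

namespace RotationDigraph

variable {V E : Type*} (G : RotationDigraph V E)

/-- The generator of the free group on the edges, or its inverse, that belongs to a dart. -/
def letter (d : E × Bool) : FreeGroup E := if d.2 then .of d.1 else (.of d.1)⁻¹

/-- The word of a walk in the free group on the edges, written from right to left. -/
def word : List (E × Bool) → FreeGroup E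
  | [] => 1
  | d :: l => word l * letter d

/-- The group generated by the edges in which the words of the facial walks are trivial. (It is the
free product of the fundamental group of the surface and a free group if `G` is connected.) -/
abbrev EdgeGroup : Type _ := PresentedGroup (Set.range fun d => word (G.facialWalk d))

/-- The element of the group `G.EdgeGroup` given by a walk. -/
def holonomy (l : List (E × Bool)) : G.EdgeGroup := PresentedGroup.mk _ (word l)

lemma word_append (l l' : List (E × Bool)) : word (l ++ l') = word l' * word l := by
  induction l with
  | nil => simp [word]
  | cons d l ih => simp [word, ih, mul_assoc]

lemma letter_rev (d : E × Bool) : letter (rev d) = (letter d)⁻¹ := by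
  obtain ⟨e, b⟩ := d
  cases b <;> simp [letter, rev]

lemma rev_rev (d : E × Bool) : rev (rev d) = d := by simp [rev]

lemma head_rev (d : E × Bool) : G.head (rev d) = G.tail d := by rw [head, rev_rev]

lemma tail_rot' (d : E × Bool) : G.tail (G.rot d) = G.tail d := G.tail_rot d

lemma holonomy_cons (d : E × Bool) (l : List (E × Bool)) :
    G.holonomy (d :: l) = G.holonomy l * PresentedGroup.mk _ (letter d) :=
  map_mul (PresentedGroup.mk _) _ _

lemma holonomy_nil : G.holonomy [] = 1 := map_one _

lemma holonomy_facialWalk (d : E × Bool) : G.holonomy (G.facialWalk d) = 1 :=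
  PresentedGroup.one_of_mem ⟨d, rfl⟩

lemma holonomy_append (l l' : List (E × Bool)) :
    G.holonomy (l ++ l') = G.holonomy l' * G.holonomy l := by
  rw [holonomy, word_append, map_mul]; rfl

lemma ElementaryMove.holonomy_eq {l l' : List (E × Bool)} (h : G.ElementaryMove l l') :
    G.holonomy l = G.holonomy l' := by
  cases h with
  | spur p q d =>
    have : G.holonomy [d, rev d] = 1 := by
      simp [holonomy, word, letter_rev]
    simp only [holonomy_append, this, one_mul]
  | face p q d => simp only [holonomy_append, holonomy_facialWalk, one_mul]

lemma Contractible.holonomy_eq_one {l : List (E × Bool)} (h : G.Contractible l) :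
    G.holonomy l = 1 := by
  obtain ⟨v, -, h⟩ := h
  rw [← G.holonomy_nil]
  generalize ([] : List (E × Bool)) = l' at h
  induction h with
  | rel _ _ h => exact h.2.2.holonomy_eq
  | refl => rfl
  | symm _ _ _ ih => exact ih.symm
  | trans _ _ _ _ _ ih1 ih2 => exact ih1.trans ih2

variable {G} in
lemma IsTwoTwoRegular.exists_swap [Finite E] (h : G.IsTwoTwoRegular) :
    ∃ s : E × Bool → E × Bool, Function.Injective s ∧
      ∀ d, G.tail (s d) = G.tail d ∧ (s d).2 = !d.2 := by
  have e : ∀ v, Nonempty ({e : E // G.src e = v} ≃ {e : E // G.tgt e = v}) := fun v =>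
    Finite.card_eq.1 ((h v).2.trans (h v).1.symm)
  let e := fun v => (e v).some
  let κ : E ≃ E := Equiv.ofFiberEquiv e
  have hκ : ∀ x, G.tgt (κ x) = G.src x := fun x => Equiv.ofFiberEquiv_map e x
  have hκ' : ∀ x, G.src (κ.symm x) = G.tgt x := fun x => by rw [← hκ, κ.apply_symm_apply]
  refine ⟨fun d => if d.2 then (κ d.1, false) else (κ.symm d.1, true), ?_, ?_⟩
  · rintro ⟨x, b⟩ ⟨y, b'⟩ hxy
    cases b <;> cases b' <;> simp_all
  · rintro ⟨x, b⟩
    cases b <;> simp [tail, hκ, hκ']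

/-- For connected `G`, a disjoint union of copies of the universal cover of the surface: the
vertices are the pairs of an element of `G.EdgeGroup` and a vertex of `G`, and traversing a dart
multiplies the group element from the left by the letter of this dart. -/
def cover [Finite E] (s : E × Bool → E × Bool) (hs : Function.Injective s)
    (hs' : ∀ d, G.tail (s d) = G.tail d ∧ (s d).2 = !d.2) :
    BalancedMap (G.EdgeGroup × (E × Bool)) (G.EdgeGroup × V) where
  inv x := (PresentedGroup.mk _ (letter x.2) * x.1, rev x.2)
  inv_inv x := by
    simp only [letter_rev, rev_rev, ← mul_assoc, map_inv, inv_mul_cancel, one_mul]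
  rot x := (x.1, G.rot x.2)
  tail x := (x.1, G.tail x.2)
  tail_rot x := by simp only [tail_rot']
  exists_rot := by
    rintro ⟨g, d⟩ ⟨g', d'⟩ h
    obtain ⟨rfl, h⟩ := Prod.mk.inj h
    obtain ⟨k, hk⟩ := (G.sameCycle_rot d d' h).exists_nat_pow_eq
    refine ⟨k, ?_⟩
    rw [← hk, show (fun x : G.EdgeGroup × (E × Bool) => (x.1, G.rot x.2)) = Prod.map id G.rot
      from rfl, Prod.map_iterate, Equiv.Perm.iterate_eq_pow]
    simp
  fwd x := x.2.2
  fwd_inv x := rfl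
  swap x := (x.1, s x.2)
  swap_injective := by
    rintro ⟨g, d⟩ ⟨g', d'⟩ h
    obtain ⟨rfl, h⟩ := Prod.mk.inj h
    exact congrArg (Prod.mk g) (hs h)
  tail_swap x := by simp only [(hs' x.2).1]
  fwd_swap x := (hs' x.2).2

/-- The lift of a walk to the cover. -/
def lift : G.EdgeGroup → List (E × Bool) → List (G.EdgeGroup × (E × Bool))
  | _, [] => []
  | g, d :: l => (g, d) :: lift (PresentedGroup.mk _ (letter d) * g) l

section Cover

variable [Finite E] {s : E × Bool → E × Bool} (hs : Function.Injective s)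
  (hs' : ∀ d, G.tail (s d) = G.tail d ∧ (s d).2 = !d.2)

variable {G} in
lemma IsWalk.lift {u v : V} {l : List (E × Bool)} (h : G.IsWalk u l v) (g : G.EdgeGroup) :
    (G.cover s hs hs').IsPath (g, u) (G.lift g l) (G.holonomy l * g, v) := by
  induction l generalizing u g with
  | nil => cases h; rw [holonomy_nil, one_mul]; rfl
  | cons d l ih =>
    refine ⟨by rw [← h.1]; rfl, ?_⟩
    rw [holonomy_cons, mul_assoc]
    exact ih h.2 _

lemma eq_lift_of_isPath {u v : G.EdgeGroup × V} {l : List (G.EdgeGroup × (E × Bool))}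
    (h : (G.cover s hs hs').IsPath u l v) :
    l = G.lift u.1 (l.map Prod.snd) ∧ v.1 = G.holonomy (l.map Prod.snd) * u.1 := by
  induction l generalizing u with
  | nil => cases h; simp [lift, holonomy_nil]
  | cons d l ih =>
    obtain ⟨h1, h2⟩ := h
    obtain ⟨h3, h4⟩ := ih h2
    have h5 : d.1 = u.1 := by rw [← h1]; rfl
    rw [List.map_cons, holonomy_cons, mul_assoc, ← h5, lift]
    exact ⟨congrArg (d :: ·) h3, h4⟩

lemma iterate_next_cover (g : G.EdgeGroup) (d : E × Bool) (k : ℕ) :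
    List.iterate (G.cover s hs hs').next (g, d) k = G.lift g (List.iterate G.faceStep d k) ∧
    (G.cover s hs hs').next^[k] (g, d) =
      (G.holonomy (List.iterate G.faceStep d k) * g, G.faceStep^[k] d) := by
  induction k generalizing g d with
  | zero => simp [List.iterate, lift, holonomy_nil]
  | succ k ih =>
    obtain ⟨h1, h2⟩ := ih (PresentedGroup.mk _ (letter d) * g) (G.faceStep d)
    rw [Function.iterate_succ_apply, Function.iterate_succ_apply, List.iterate, List.iterate,
      holonomy_cons, mul_assoc, lift]
    exact ⟨congrArg (_ :: ·) h1, h2⟩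

lemma next_cover_injective : Function.Injective (G.cover s hs hs').next := by
  rintro ⟨g, d⟩ ⟨g', d'⟩ h
  obtain ⟨h1, h2⟩ := Prod.mk.inj h
  obtain rfl : d = d' := G.faceStep.injective h2
  exact congrArg (fun a => (a, d)) (mul_left_cancel h1)

/-- The monodromy along an edge: it moves along the edge in the cover and records the traversal of
the lifted edge as a `1`-chain modulo boundaries. -/
noncomputable def monodromy (e : E) : Equiv.Perm
    (G.EdgeGroup × ((G.EdgeGroup × (E × Bool) → ℤ) ⧸ (G.cover s hs hs').boundaries)) where
  toFun x := (PresentedGroup.mk _ (letter (e, true)) * x.1,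
    x.2 + QuotientAddGroup.mk ((G.cover s hs hs').flux [(x.1, (e, true))]))
  invFun x := (PresentedGroup.mk _ (letter (e, false)) * x.1,
    x.2 + QuotientAddGroup.mk ((G.cover s hs hs').flux [(x.1, (e, false))]))
  left_inv x := by
    have h1 : (G.cover s hs hs').flux [(PresentedGroup.mk _ (letter (e, true)) * x.1, (e, false))] =
        -(G.cover s hs hs').flux [(x.1, (e, true))] := BalancedMap.flux_inv (x.1, (e, true))
    have h2 := congrArg Prod.fst ((G.cover s hs hs').inv_inv (x.1, (e, true)))
    refine Prod.ext h2 ?_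
    change x.2 + _ + _ = x.2
    rw [h1, QuotientAddGroup.mk_neg, add_neg_cancel_right]
  right_inv x := by
    have h1 : (G.cover s hs hs').flux [(PresentedGroup.mk _ (letter (e, false)) * x.1, (e, true))] =
        -(G.cover s hs hs').flux [(x.1, (e, false))] := BalancedMap.flux_inv (x.1, (e, false))
    have h2 := congrArg Prod.fst ((G.cover s hs hs').inv_inv (x.1, (e, false)))
    refine Prod.ext h2 ?_
    change x.2 + _ + _ = x.2
    rw [h1, QuotientAddGroup.mk_neg, add_neg_cancel_right]

lemma lift_monodromy (l : List (E × Bool)) (g : G.EdgeGroup)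
    (a : (G.EdgeGroup × (E × Bool) → ℤ) ⧸ (G.cover s hs hs').boundaries) :
    FreeGroup.lift (G.monodromy hs hs') (word l) (g, a) = (G.holonomy l * g,
      a + QuotientAddGroup.mk ((G.cover s hs hs').flux (G.lift g l))) := by
  induction l generalizing g a with
  | nil => simp [word, holonomy_nil, lift, BalancedMap.flux_nil]
  | cons d l ih =>
    have h1 : FreeGroup.lift (G.monodromy hs hs') (letter d) (g, a) =
        (PresentedGroup.mk _ (letter d) * g,
          a + QuotientAddGroup.mk ((G.cover s hs hs').flux [(g, d)])) := by
      obtain ⟨e, b⟩ := d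
      cases b
      · simp only [letter, Bool.false_eq_true, if_false, map_inv, FreeGroup.lift_apply_of]
        rfl
      · simp only [letter, if_true, FreeGroup.lift_apply_of]
        rfl
    rw [word, map_mul, Equiv.Perm.mul_apply, h1, ih, holonomy_cons, mul_assoc, lift,
      BalancedMap.flux_cons (g, d) (G.lift _ l), QuotientAddGroup.mk_add, add_assoc]

/-- The cover is simply connected. The facial walks act trivially under the monodromy, and hence so
does every walk with trivial holonomy. -/
lemma acyclic_cover : (G.cover s hs hs').Acyclic := by
  have hrel : ∀ r ∈ Set.range fun d => word (G.facialWalk d),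
      FreeGroup.lift (G.monodromy hs hs') r = 1 := by
    rintro _ ⟨d, rfl⟩
    ext1 ⟨g, a⟩
    obtain ⟨h1, h2⟩ := G.iterate_next_cover hs hs' g d (Function.minimalPeriod G.faceStep d)
    have h3 := G.holonomy_facialWalk d
    rw [facialWalk] at h3
    rw [h3, one_mul, Function.iterate_minimalPeriod] at h2
    have h4 := BalancedMap.flux_iterate_mem (G.next_cover_injective hs hs') h2
    rw [h1] at h4
    rw [lift_monodromy, facialWalk, h3, one_mul, (QuotientAddGroup.eq_zero_iff _).2 h4, add_zero]
    rfl
  intro u l _ hl _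
  obtain ⟨h1, h2⟩ := G.eq_lift_of_isPath hs hs' hl
  have h3 : PresentedGroup.mk (Set.range fun d => word (G.facialWalk d))
      (word (l.map Prod.snd)) = 1 := mul_eq_right.1 h2.symm
  have h4 : FreeGroup.lift (G.monodromy hs hs') (word (l.map Prod.snd)) = 1 :=
    congrArg (PresentedGroup.toGroup hrel) h3 |>.trans (map_one _)
  have h5 := G.lift_monodromy hs hs' (l.map Prod.snd) u.1 0
  rw [h4, ← h1, zero_add] at h5
  rw [BalancedMap.exists_bounds_iff, ← QuotientAddGroup.eq_zero_iff]
  exact (congrArg Prod.snd h5).symm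

end Cover

end RotationDigraph

/-! ### Directed circuits and faces -/

namespace RotationDigraph

variable {V E : Type*} (G : RotationDigraph V E)

/-- The walk traversed backwards. -/
def revWalk (l : List (E × Bool)) : List (E × Bool) := (l.map rev).reverse

lemma revWalk_cons (d : E × Bool) (l : List (E × Bool)) :
    revWalk (d :: l) = revWalk l ++ [rev d] := by simp [revWalk]

lemma revWalk_revWalk (l : List (E × Bool)) : revWalk (revWalk l) = l := by
  simp [revWalk, List.map_reverse, Function.comp_def, rev_rev]

lemma tail_faceStep (d : E × Bool) : G.tail (G.faceStep d) = G.head d := G.tail_rot (rev d)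

variable {G}

lemma IsWalk.append {u v w : V} {l l' : List (E × Bool)} (h : G.IsWalk u l v)
    (h' : G.IsWalk v l' w) : G.IsWalk u (l ++ l') w := by
  induction l generalizing u with
  | nil => cases h; exact h'
  | cons d l ih => exact ⟨h.1, ih h.2⟩

lemma IsWalk.revWalk {u v : V} {l : List (E × Bool)} (h : G.IsWalk u l v) :
    G.IsWalk v (revWalk l) u := by
  induction l generalizing u with
  | nil => exact Eq.symm h
  | cons d l ih =>
    rw [revWalk_cons]
    exact (ih h.2).append ⟨rfl, (G.head_rev d).trans h.1⟩

variable (G)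

lemma isWalk_iterate (d : E × Bool) (k : ℕ) :
    G.IsWalk (G.tail d) (List.iterate G.faceStep d k) (G.tail (G.faceStep^[k] d)) := by
  induction k generalizing d with
  | zero => rfl
  | succ k ih =>
    refine ⟨rfl, ?_⟩
    rw [← tail_faceStep]
    exact ih _

lemma isWalk_facialWalk (d : E × Bool) :
    G.IsWalk (G.tail d) (G.facialWalk d) (G.tail d) := by
  have := G.isWalk_iterate d (Function.minimalPeriod G.faceStep d)
  rwa [Function.iterate_minimalPeriod] at this

lemma nodup_facialWalk (d : E × Bool) : (G.facialWalk d).Nodup := by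
  rw [facialWalk, ← List.range_map_iterate, List.nodup_map_iff_inj_on List.nodup_range]
  intro i hi j hj hij
  exact Function.iterate_injOn_Iio_minimalPeriod (by simpa using hi) (by simpa using hj) hij

lemma facialWalk_ne_nil [Finite E] (d : E × Bool) : G.facialWalk d ≠ [] := by
  have h : d ∈ Function.periodicPts G.faceStep :=
    Function.Injective.mem_periodicPts G.faceStep.injective d
  rw [facialWalk, Ne, List.iterate_eq_nil]
  exact (Function.minimalPeriod_pos_of_mem_periodicPts h).ne'

lemma contractible_facialWalk (d : E × Bool) : G.Contractible (G.facialWalk d) := by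
  refine ⟨_, G.isWalk_facialWalk d,
    (Relation.EqvGen.rel _ _ ⟨rfl, G.isWalk_facialWalk d, ?_⟩).symm⟩
  simpa using ElementaryMove.face (G := G) [] [] d

variable {G}

/-- A walk followed by the same walk backwards can be inserted by a homotopy. -/
lemma IsWalk.homotopic_spur {u v w x : V} {p l q : List (E × Bool)} (hp : G.IsWalk u p w)
    (hl : G.IsWalk w l x) (hq : G.IsWalk w q v) :
    G.Homotopic u v (p ++ q) (p ++ (l ++ RotationDigraph.revWalk l) ++ q) := by
  induction l generalizing p q w with
  | nil => simpa [RotationDigraph.revWalk, Homotopic] using Relation.EqvGen.refl _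
  | cons d l ih =>
    obtain ⟨rfl, hl⟩ := hl
    have hd : G.IsWalk (G.tail d) [d] (G.head d) := ⟨rfl, rfl⟩
    have hd' : G.IsWalk (G.head d) [rev d] (G.tail d) := ⟨rfl, G.head_rev d⟩
    have h1 := ih (hp.append hd) hl (hd'.append hq)
    refine .trans _ _ _ (.rel _ _ ⟨hp.append hq, ?_, .spur p q d⟩) ?_
    · exact (hp.append (hd.append hd')).append hq
    · rw [revWalk_cons]
      simpa [Homotopic] using h1

variable (G)

lemma contractible_revWalk_facialWalk (d : E × Bool) :
    G.Contractible (revWalk (G.facialWalk d)) := by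
  have hw := G.isWalk_facialWalk d
  refine ⟨_, hw.revWalk, .trans _ (G.facialWalk d ++ revWalk (G.facialWalk d)) _ ?_ ?_⟩
  · exact .rel _ _ ⟨hw.revWalk, hw.append hw.revWalk, ElementaryMove.face [] _ d⟩
  · have := IsWalk.homotopic_spur (G := G) (p := []) (q := []) rfl hw rfl
    simpa using this.symm

variable {G}

lemma Bounds.contractible {c : List E} {f : G.Face} (h : G.Bounds c f) :
    G.Contractible (along c) := by
  obtain ⟨-, d, -, h | h⟩ := h
  · rw [← h]
    exact G.contractible_facialWalk d
  · have h1 : along c = revWalk (G.facialWalk d) := by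
      rw [h]; exact (revWalk_revWalk _).symm
    rw [h1]
    exact G.contractible_revWalk_facialWalk d

lemma along_map_fst {l : List (E × Bool)} (h : ∀ x ∈ l, x.2 = true) :
    along (l.map Prod.fst) = l := by
  rw [along, List.map_map]
  conv_rhs => rw [← List.map_id l]
  exact List.map_congr_left fun x hx => Prod.ext rfl (h x hx).symm

lemma exists_bounds_of_monochromatic [Finite E] {d : E × Bool}
    (h : ∀ k : ℕ, (G.faceStep^[k] d).2 = d.2) : ∃ (f : G.Face) (c : List E), G.Bounds c f := by
  have hmem : ∀ x ∈ G.facialWalk d, x.2 = d.2 := by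
    intro x hx
    obtain ⟨m, -, rfl⟩ := List.mem_iterate.1 hx
    exact h m
  have circuit : ∀ l : List (E × Bool), l ≠ [] → l.Nodup → G.IsWalk (G.tail d) l (G.tail d) →
      (∀ x ∈ l, x.2 = true) → G.IsDirectedCircuit (l.map Prod.fst) := by
    intro l h1 h2 h3 h4
    have h5 := along_map_fst h4
    refine ⟨by simpa using h1, ?_, G.tail d, by rwa [h5]⟩
    rw [← h5] at h2
    exact h2.of_map _
  have hne := G.facialWalk_ne_nil d
  have hnd := G.nodup_facialWalk d
  have hw := G.isWalk_facialWalk d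
  cases hb : d.2
  · have htrue : ∀ x ∈ revWalk (G.facialWalk d), x.2 = true := by
      intro x hx
      obtain ⟨y, hy, rfl⟩ : ∃ y ∈ G.facialWalk d, rev y = x := by simpa [revWalk] using hx
      simp [rev, hmem y hy, hb]
    refine ⟨G.faceOf d, (revWalk (G.facialWalk d)).map Prod.fst, circuit _ ?_ ?_ hw.revWalk htrue,
      d, rfl, Or.inr ?_⟩
    · simpa [revWalk] using hne
    · exact List.nodup_reverse.2 (hnd.map rev.injective)
    · rw [along_map_fst htrue]
      exact (revWalk_revWalk _).symm
  · have htrue : ∀ x ∈ G.facialWalk d, x.2 = true := fun x hx => (hmem x hx).trans hb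
    exact ⟨G.faceOf d, (G.facialWalk d).map Prod.fst, circuit _ hne hnd hw htrue,
      d, rfl, Or.inl (along_map_fst htrue).symm⟩

/-- A contractible directed circuit lifts to a directed closed walk in the universal cover. Hence
some face of the cover is bounded by a directed walk, and so is the face below it. -/
theorem IsTwoTwoRegular.exists_monochromatic [Finite E] (hG : G.IsTwoTwoRegular) {c : List E}
    (hc : G.IsDirectedCircuit c) (hcon : G.Contractible (along c)) :
    ∃ d, ∀ k : ℕ, (G.faceStep^[k] d).2 = d.2 := by
  obtain ⟨s, hs, hs'⟩ := hG.exists_swap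
  obtain ⟨hne, -, v, hv⟩ := hc
  have hlift := hv.lift hs hs' 1
  rw [hcon.holonomy_eq_one, one_mul] at hlift
  have hmem : ∀ (l : List E) g, ∀ x ∈ G.lift g (along l), x.2.2 = true := by
    intro l
    induction l with
    | nil => simp [along, lift]
    | cons e l ih =>
      intro g x hx
      rcases List.mem_cons.1 hx with rfl | hx
      · rfl
      · exact ih _ x hx
  obtain ⟨⟨g, d⟩, hd⟩ := (G.acyclic_cover hs hs').exists_monochromatic (by
    obtain ⟨e, l, rfl⟩ := List.exists_cons_of_ne_nil hne
    simp [along, lift]) hlift (hmem c 1)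
  refine ⟨d, fun k => ?_⟩
  have := hd k
  rwa [(G.iterate_next_cover hs hs' g d k).2] at this

lemma IsTwoTwoRegular.exists_bounds [Finite E] (hG : G.IsTwoTwoRegular)
    (h : ∃ c : List E, G.IsDirectedCircuit c ∧ G.Contractible (along c)) :
    ∃ (f : G.Face) (c : List E), G.Bounds c f := by
  obtain ⟨c, hc, hcon⟩ := h
  obtain ⟨d, hd⟩ := hG.exists_monochromatic hc hcon
  exact exists_bounds_of_monochromatic hd

lemma IsTwoTwoRegular.allCircuitsNoncontractible_iff [Finite E] (hG : G.IsTwoTwoRegular) :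
    G.AllCircuitsNoncontractible ↔ ¬ ∃ (f : G.Face) (c : List E), G.Bounds c f := by
  refine ⟨fun h ⟨f, c, hc⟩ => h c hc.1 hc.contractible, fun h c hc hcon => h ?_⟩
  exact hG.exists_bounds ⟨c, hc, hcon⟩

lemma IsTwoTwoRegular.allCircuitsNoncontractible_iff_forall [Finite E] (hG : G.IsTwoTwoRegular) :
    G.AllCircuitsNoncontractible ↔ ∀ d, ∃ k : ℕ, (G.faceStep^[k] d).2 ≠ d.2 := by
  constructor
  · intro h d
    by_contra! hd
    exact hG.allCircuitsNoncontractible_iff.1 h (exists_bounds_of_monochromatic hd)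
  · intro h c hc hcon
    obtain ⟨d, hd⟩ := hG.exists_monochromatic hc hcon
    obtain ⟨k, hk⟩ := h d
    exact hk (hd k)

end RotationDigraph

/-! ### Detecting monochromatic orbits -/

section Trace

variable {D : Type*} (f : Equiv.Perm D) (o : D → Bool)

/-- `M` is a union of orbits of `f`, none of which is monochromatic. -/
structure IsCleared (M : Finset D) : Prop where
  mem_iff : ∀ d, f d ∈ M ↔ d ∈ M
  exists_ne : ∀ d ∈ M, ∃ k : ℕ, o (f^[k] d) ≠ o d

lemma IsCleared.iterate_mem_iff {f : Equiv.Perm D} {o : D → Bool} {M : Finset D}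
    (h : IsCleared f o M) (d : D) (k : ℕ) : f^[k] d ∈ M ↔ d ∈ M := by
  induction k with
  | zero => rfl
  | succ k ih => rw [Function.iterate_succ_apply', h.mem_iff, ih]

variable [DecidableEq D]

/-- The invariant of the search for a monochromatic orbit. The darts `d` with `i ≤ code d` have been
dealt with and lie in a cleared set; the search follows the orbit of the dart `s` with
`code s = i - 1` and has reached `cur`. The set `M` consists of the darts visited so far, and
`flag` tells whether the colour has changed along the current orbit. If `s` was visited before,
`flag` is set at once. -/
def TraceInv (code : D → ℕ) (i : ℕ) (cur : D) (flag : ℕ) (M : Finset D) : Prop :=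
  ∃ (M₀ : Finset D) (s : D) (j : ℕ), code s + 1 = i ∧ IsCleared f o M₀ ∧
    (∀ d, i ≤ code d → d ∈ M₀) ∧ cur = f^[j] s ∧
    M = M₀ ∪ (Finset.range j).image (fun l => f^[l] s) ∧ (s ∈ M₀ → j = 0 ∧ flag ≠ 0) ∧
    (s ∉ M₀ → (flag = 0 ↔ ∀ l < j, o (f^[l + 1] s) = o (f^[l] s)))

variable {f o} {code : D → ℕ} {i flag : ℕ} {cur : D} {M : Finset D}

lemma IsCleared.traceInv (h : IsCleared f o M) (hi : ∀ d, i ≤ code d → d ∈ M) {s : D}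
    (hs : code s + 1 = i) : TraceInv f o code i s (if s ∈ M then 1 else 0) M :=
  ⟨M, s, 0, hs, h, hi, rfl, by simp, fun h => by simp [h], fun h => by simp [h]⟩

lemma TraceInv.visit (h : TraceInv f o code i cur flag M) (hcur : cur ∉ M) :
    TraceInv f o code i (f cur) (flag + if o (f cur) = o cur then 0 else 1) (insert cur M) := by
  obtain ⟨M₀, s, j, hs, h0, hi, rfl, rfl, hsM, hsM'⟩ := h
  have hs0 : s ∉ M₀ := by
    intro hs0
    obtain ⟨rfl, -⟩ := hsM hs0
    exact hcur (by simpa using hs0)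
  refine ⟨M₀, s, j + 1, hs, h0, hi, (Function.iterate_succ_apply' _ _ _).symm, ?_,
    fun h => absurd h hs0, fun _ => ?_⟩
  · rw [Finset.range_add_one, Finset.image_insert, Finset.union_insert]
  · have h1 := hsM' hs0
    rw [Nat.forall_lt_succ_right, ← h1, Function.iterate_succ_apply']
    split_ifs <;> simp_all

lemma TraceInv.exists_period (h : TraceInv f o code i cur flag M) (hcur : cur ∈ M) :
    ∃ (M₀ : Finset D) (s : D) (j : ℕ), code s + 1 = i ∧ IsCleared f o M₀ ∧
    (∀ d, i ≤ code d → d ∈ M₀) ∧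
    M = M₀ ∪ (Finset.range j).image (fun l => f^[l] s) ∧ ((s ∈ M₀ ∧ j = 0 ∧ flag ≠ 0) ∨
    (s ∉ M₀ ∧ (flag = 0 ↔ ∀ l < j, o (f^[l + 1] s) = o (f^[l] s)) ∧
      ∃ p, 0 < p ∧ p ≤ j ∧ f^[p] s = s)) := by
  obtain ⟨M₀, s, j, hs, h0, hi, rfl, rfl, hsM, hsM'⟩ := h
  refine ⟨M₀, s, j, hs, h0, hi, rfl, ?_⟩
  by_cases hs0 : s ∈ M₀
  · exact Or.inl ⟨hs0, hsM hs0⟩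
  · refine Or.inr ⟨hs0, hsM' hs0, ?_⟩
    rcases Finset.mem_union.1 hcur with h1 | h1
    · exact absurd ((h0.iterate_mem_iff s j).1 h1) hs0
    · obtain ⟨l, hl, hlj⟩ := Finset.mem_image.1 h1
      rw [Finset.mem_range] at hl
      refine ⟨j - l, by omega, by omega, f.injective.iterate l ?_⟩
      rw [← Function.iterate_add_apply, hlj]
      congr 2
      omega

lemma TraceInv.exists_monochromatic (h : TraceInv f o code i cur 0 M) (hcur : cur ∈ M) :
    ∃ d, ∀ k : ℕ, o (f^[k] d) = o d := by
  obtain ⟨M₀, s, j, -, -, -, -, h1 | ⟨-, h1, p, hp, hpj, hps⟩⟩ := h.exists_period hcur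
  · exact absurd rfl h1.2.2
  · have h2 : ∀ l ≤ j, o (f^[l] s) = o s := by
      intro l
      induction l with
      | zero => intro _; rfl
      | succ l ih => intro hl; rw [h1.1 rfl l (by omega), ih (by omega)]
    refine ⟨s, fun k => ?_⟩
    rw [← Function.IsPeriodicPt.iterate_mod_apply (show Function.IsPeriodicPt f p s from hps) k]
    exact h2 _ ((Nat.mod_lt k hp).le.trans hpj)

lemma TraceInv.isCleared (h : TraceInv f o code i cur flag M) (hcur : cur ∈ M) (hflag : flag ≠ 0)
    (hcode : Function.Injective code) : IsCleared f o M ∧ ∀ d, i - 1 ≤ code d → d ∈ M := by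
  obtain ⟨M₀, s, j, hs, h0, hi, rfl, h1⟩ := h.exists_period hcur
  have hlast : s ∈ M₀ ∪ (Finset.range j).image (fun l => f^[l] s) := by
    rcases h1 with ⟨h1, -⟩ | ⟨-, -, p, hp, hpj, -⟩
    · exact Finset.mem_union_left _ h1
    · exact Finset.mem_union_right _ (Finset.mem_image.2 ⟨0, by simp; omega, rfl⟩)
  refine ⟨?_, fun d hd => ?_⟩
  · rcases h1 with ⟨-, rfl, -⟩ | ⟨hs0, h1, p, hp, hpj, hps⟩
    · simpa using h0
    · have hper : Function.IsPeriodicPt f p s := hps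
      have hmem : ∀ d, d ∈ (Finset.range j).image (fun l => f^[l] s) ↔ ∃ k : ℕ, f^[k] s = d := by
        intro d
        simp only [Finset.mem_image, Finset.mem_range]
        refine ⟨fun ⟨l, _, h⟩ => ⟨l, h⟩, fun ⟨k, h⟩ => ⟨k % p, (Nat.mod_lt k hp).trans_le hpj, ?_⟩⟩
        rw [hper.iterate_mod_apply, h]
      constructor
      · intro d
        rw [Finset.mem_union, Finset.mem_union, h0.mem_iff, hmem, hmem]
        refine or_congr_right ⟨fun ⟨k, hk⟩ => ⟨k + (p - 1), f.injective ?_⟩,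
          fun ⟨k, hk⟩ => ⟨k + 1, by rw [Function.iterate_succ_apply', hk]⟩⟩
        rw [← Function.iterate_succ_apply' f, show (k + (p - 1)).succ = k + p by omega,
          Function.iterate_add_apply, hps, hk]
      · intro d hd
        rcases Finset.mem_union.1 hd with hd | hd
        · exact h0.exists_ne d hd
        · obtain ⟨l, rfl⟩ := (hmem d).1 hd
          have h2 : ¬ ∀ l < j, o (f^[l + 1] s) = o (f^[l] s) := fun h => hflag (h1.2 h)
          push Not at h2
          obtain ⟨q, -, hq⟩ := h2
          by_contra! hmono
          -- the colour change at the `q`-th dart occurs again later than the `l`-th dart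
          have h3 : ∀ a, o (f^[a] s) = o (f^[l] s) := by
            intro a
            have h4 : f^[a + p * l] s = f^[a] s := by
              rw [Function.iterate_add_apply, (hper.mul_const l).eq]
            have h5 : l ≤ a + p * l := by nlinarith
            rw [← h4, ← hmono (a + p * l - l), ← Function.iterate_add_apply,
              Nat.sub_add_cancel h5]
          exact hq ((h3 _).trans (h3 _).symm)
  · rcases Nat.lt_or_ge (code d) i with h2 | h2
    · obtain rfl : d = s := hcode (by omega)
      exact hlast
    · exact Finset.mem_union_left _ (hi d h2)

end Trace

/-! ### A program for the random access machine -/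

open RAMInstr in
/-- The program. From the input it builds two copies, `4 * n` cells apart, of the table of the
clockwise rotation, so that the code of the dart that follows the dart with code `c` in face tracing
stands in cell `6 * n + 1 + c`. The cells from `12 * n + 1` on are marks for the visited darts. Then
it follows the facial walks, adding to register `7` whenever the direction changes.

Register `1` is always `0`; registers `2`, `3`, `4`, `8`, `9`, `15` hold `1`, `2 * n`, `4 * n` and
the addresses `6 * n + 1`, `12 * n + 1`, `4 * n + 1`; register `5` counts down; register `6` is the
position in the input or the current dart. -/
def faceProgram : List RAMInstr :=
  [const 2 1, load 3 1, add 5 3 1, add 3 3 3, add 4 3 3, add 15 4 2, add 8 15 3, add 9 15 4,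
   add 9 9 4, add 6 2 1,
   -- `10`: read the next vertex
   jumpZero 5 37,
   load 10 6, add 6 6 2, load 11 6, add 6 6 2, load 12 6, add 6 6 2, load 13 6, add 6 6 2,
   add 14 15 10, store 14 11, add 14 14 4, store 14 11,
   add 14 15 11, store 14 12, add 14 14 4, store 14 12,
   add 14 15 12, store 14 13, add 14 14 4, store 14 13,
   add 14 15 13, store 14 10, add 14 14 4, store 14 10,
   sub 5 5 2, jumpZero 1 10,
   -- `37`: start the search
   add 5 4 1, sub 6 5 2, const 7 0,
   -- `40`: has the current dart been visited?
   jumpZero 5 63, add 14 9 6, load 10 14, jumpZero 10 50,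
   -- `44`: end of an orbit
   jumpZero 7 64, sub 5 5 2, sub 6 5 2, add 14 9 6, load 7 14, jumpZero 1 40,
   -- `50`: visit the current dart
   store 14 2, add 14 8 6, load 10 14,
   sub 11 3 6, sub 11 2 11, sub 12 3 10, sub 12 2 12, sub 13 11 12, sub 12 12 11, add 13 13 12,
   add 7 7 13, add 6 10 1, jumpZero 1 40,
   -- `63`: no monochromatic orbit
   add 0 2 1]

namespace RAMState

lemma run_succ (P : List RAMInstr) (s : RAMState) (t : ℕ) :
    run P s (t + 1) = run P (step P s) t := rfl

lemma run_zero (P : List RAMInstr) (s : RAMState) : run P s 0 = s := rfl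

lemma run_add (P : List RAMInstr) (s : RAMState) (t t' : ℕ) :
    run P s (t + t') = run P (run P s t) t' := by
  rw [run, run, run, Nat.add_comm, Function.iterate_add_apply]

/-- No register and no memory cell holds a number greater than `B`. -/
def Bounded (B : ℕ) (s : RAMState) : Prop := ∀ k, s.reg k ≤ B ∧ s.mem k ≤ B

/-- Within `T` steps the program `P` leads from `s` to `s'`, and no number greater than `B`
occurs. -/
def Reaches (P : List RAMInstr) (B T : ℕ) (s s' : RAMState) : Prop :=
  ∃ t ≤ T, run P s t = s' ∧ ∀ i ≤ t, Bounded B (run P s i)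

lemma Reaches.trans {P : List RAMInstr} {B T T' : ℕ} {s s' s'' : RAMState}
    (h : Reaches P B T s s') (h' : Reaches P B T' s' s'') : Reaches P B (T + T') s s'' := by
  obtain ⟨t, ht, rfl, hb⟩ := h
  obtain ⟨t', ht', rfl, hb'⟩ := h'
  refine ⟨t + t', by omega, run_add _ _ _ _, fun i hi => ?_⟩
  rcases Nat.le_total i t with h | h
  · exact hb i h
  · obtain ⟨j, rfl⟩ := Nat.exists_eq_add_of_le h
    rw [run_add]
    exact hb' j (by omega)

lemma Reaches.mono {P : List RAMInstr} {B T T' : ℕ} {s s' : RAMState}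
    (h : Reaches P B T s s') (hT : T ≤ T') : Reaches P B T' s s' := by
  obtain ⟨t, ht, h1, hb⟩ := h
  exact ⟨t, ht.trans hT, h1, hb⟩

lemma update_le {B : ℕ} {g : ℕ → ℕ} (hg : ∀ k, g k ≤ B) {r x : ℕ} (hx : x ≤ B) (k : ℕ) :
    Function.update g r x k ≤ B := by
  rw [Function.update_apply]
  split_ifs
  · exact hx
  · exact hg k

/-- A single step at most doubles the largest number. -/
lemma Bounded.step {P : List RAMInstr} {B : ℕ} {s : RAMState}
    (hP : ∀ r k, RAMInstr.const r k ∈ P → k ≤ B) (hs : Bounded B s) :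
    Bounded (2 * B) (step P s) := by
  have hr : ∀ k, s.reg k ≤ 2 * B := fun k => (hs k).1.trans (by omega)
  have hm : ∀ k, s.mem k ≤ 2 * B := fun k => (hs k).2.trans (by omega)
  rw [RAMState.step]
  cases hi : P[s.pc]? with
  | none => exact fun k => ⟨hr k, hm k⟩
  | some i =>
    cases i with
    | const r x =>
      have hx := hP r x (List.mem_of_getElem? hi)
      exact fun k => ⟨update_le hr (by omega) k, hm k⟩
    | add r x y =>
      have hx := (hs x).1
      have hy := (hs y).1
      exact fun k => ⟨update_le hr (by omega) k, hm k⟩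
    | sub r x y =>
      have hx := (hs x).1
      exact fun k => ⟨update_le hr (by omega) k, hm k⟩
    | load r x => exact fun k => ⟨update_le hr (hm _) k, hm k⟩
    | store r x => exact fun k => ⟨hr k, update_le hm (hr _) k⟩
    | jumpZero r x => exact fun k => ⟨hr k, hm k⟩

/-- Since a step at most doubles the numbers, a bounded number of steps increases them by a constant
factor only. -/
lemma Bounded.reaches {B t : ℕ} {s s' : RAMState} (hs : Bounded B s) (hB : 1 ≤ B) (ht : t ≤ 30)
    (h : run faceProgram s t = s') : Reaches faceProgram (2 ^ 30 * B) 30 s s' := by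
  refine ⟨t, ht, h, fun i hi => ?_⟩
  have hconst : ∀ r k, RAMInstr.const r k ∈ faceProgram → k ≤ 1 := by
    intro r k h
    simp [faceProgram] at h
    omega
  have h1 : Bounded (2 ^ i * B) (run faceProgram s i) := by
    clear hi
    induction i with
    | zero => simpa [run_zero] using hs
    | succ i ih =>
      have h2 := ih.step fun r k h => (hconst r k h).trans (Nat.mul_pos (by positivity) hB)
      rw [← mul_assoc, ← pow_succ'] at h2
      rwa [run_add]
  have h2 : 2 ^ i * B ≤ 2 ^ 30 * B :=
    Nat.mul_le_mul_right _ (Nat.pow_le_pow_right (by norm_num) (hi.trans ht))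
  exact fun k => ⟨(h1 k).1.trans h2, (h1 k).2.trans h2⟩

/-- The registers of `faceProgram` that keep their values, and a bound for all registers; the last
memory cell in use has the address `16 * n`. -/
structure ConstRegs (n : ℕ) (reg : ℕ → ℕ) : Prop where
  reg0 : reg 0 = 0
  reg1 : reg 1 = 0
  reg2 : reg 2 = 1
  reg3 : reg 3 = 2 * n
  reg4 : reg 4 = 4 * n
  reg8 : reg 8 = 6 * n + 1
  reg9 : reg 9 = 12 * n + 1
  reg15 : reg 15 = 4 * n + 1
  le : ∀ k, reg k ≤ 16 * n + 1

end RAMState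

/-! ### The codes of the darts -/

section Codes

variable {n : ℕ}

lemma dartCode_lt (d : Fin (2 * n) × Bool) : dartCode d < 4 * n := by
  obtain ⟨e, b⟩ := d
  have := e.isLt
  cases b <;> simp only [dartCode] <;> simp <;> omega

lemma dartCode_lt_iff (d : Fin (2 * n) × Bool) : dartCode d < 2 * n ↔ d.2 = true := by
  obtain ⟨e, b⟩ := d
  have := e.isLt
  cases b <;> simp [dartCode]

lemma dartCode_injective : Function.Injective (dartCode : Fin (2 * n) × Bool → ℕ) := by
  rintro ⟨e, b⟩ ⟨e', b'⟩ h
  have h1 := e.isLt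
  have h2 := e'.isLt
  cases b <;> cases b' <;> simp [dartCode] at h ⊢ <;> omega

lemma exists_dartCode_eq {k : ℕ} (hk : k < 4 * n) :
    ∃ d : Fin (2 * n) × Bool, dartCode d = k := by
  by_cases h : k < 2 * n
  · exact ⟨(⟨k, h⟩, true), rfl⟩
  · refine ⟨(⟨k - 2 * n, by omega⟩, false), ?_⟩
    simp [dartCode]
    omega

lemma dartCode_rev (d : Fin (2 * n) × Bool) :
    dartCode d + 2 * n = dartCode (RotationDigraph.rev d) ∨
      dartCode d + 2 * n = dartCode (RotationDigraph.rev d) + 4 * n := by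
  obtain ⟨e, b⟩ := d
  cases b <;> simp [dartCode, RotationDigraph.rev] <;> omega

/-- The computation by which `faceProgram` detects a change of direction. -/
lemma direction_change (d d' : Fin (2 * n) × Bool) :
    (1 - (2 * n - dartCode d)) - (1 - (2 * n - dartCode d')) +
      ((1 - (2 * n - dartCode d')) - (1 - (2 * n - dartCode d))) =
    if d'.2 = d.2 then 0 else 1 := by
  have h1 := dartCode_lt_iff d
  have h2 := dartCode_lt_iff d'
  split_ifs with h
  · rw [h, ← h1] at h2
    omega
  · cases hd : d.2 <;> cases hd' : d'.2 <;> simp_all <;> omega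

variable {E : Type*}

lemma RotationDigraph.IsRotationTable.exists_eq [Finite E] {G : RotationDigraph (Fin n) E}
    {a : Fin n → Fin 4 → E × Bool} (ha : G.IsRotationTable a) (d : E × Bool) :
    ∃ i, d = a (G.tail d) i := by
  obtain ⟨k, hk⟩ := (G.sameCycle_rot _ d (ha (G.tail d) 0).1).exists_nat_pow_eq
  have h : ∀ k : ℕ, ∃ i, (G.rot ^ k) (a (G.tail d) 0) = a (G.tail d) i := by
    intro k
    induction k with
    | zero => exact ⟨0, rfl⟩
    | succ k ih =>
      obtain ⟨i, hi⟩ := ih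
      exact ⟨i + 1, by rw [pow_succ', Equiv.Perm.mul_apply, hi, (ha _ i).2]⟩
  obtain ⟨i, hi⟩ := h k
  exact ⟨i, hk.symm.trans hi⟩

lemma RotationDigraph.IsTwoTwoRegular.card_eq {m : ℕ} {G : RotationDigraph (Fin n) (Fin m)}
    (hG : G.IsTwoTwoRegular) : m = 2 * n := by
  have h := Nat.card_congr (Equiv.sigmaFiberEquiv G.src)
  rw [Nat.card_sigma, Finset.sum_congr rfl fun v _ => (hG v).2] at h
  simp at h
  omega

lemma encodeRotationTable_eq {m : ℕ} (a : Fin n → Fin 4 → Fin m × Bool) :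
    encodeRotationTable a =
      n :: List.ofFn fun p : Fin (n * 4) => dartCode (a p.divNat p.modNat) := by
  rw [encodeRotationTable, List.ofFn_mul]
  congr 3
  funext v
  congr 1
  funext i
  have h1 : (⟨v * 4 + i, by omega⟩ : Fin (n * 4)).divNat = v := by
    ext; simp [Fin.divNat]; omega
  have h2 : (⟨v * 4 + i, by omega⟩ : Fin (n * 4)).modNat = i := by
    ext; simp [Fin.modNat]
  rw [h1, h2]

lemma getD_encodeRotationTable {m : ℕ} (a : Fin n → Fin 4 → Fin m × Bool) (v : Fin n)
    (i : Fin 4) : (encodeRotationTable a).getD (1 + 4 * v + i) 0 = dartCode (a v i) := by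
  have hlt : 4 * (v : ℕ) + i < n * 4 := by omega
  have h1 : (⟨4 * v + i, hlt⟩ : Fin (n * 4)).divNat = v := by
    ext; simp [Fin.divNat]; omega
  have h2 : (⟨4 * v + i, hlt⟩ : Fin (n * 4)).modNat = i := by
    ext; simp [Fin.modNat]
  rw [encodeRotationTable_eq, show 1 + 4 * (v : ℕ) + i = (4 * v + i) + 1 by ring,
    List.getD_cons_succ, List.getD_eq_getElem _ _ (by simpa using hlt), List.getElem_ofFn, h1, h2]

lemma getD_encodeRotationTable_of_lt {m : ℕ} (a : Fin n → Fin 4 → Fin m × Bool) {p : ℕ}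
    (hp : 4 * n < p) : (encodeRotationTable a).getD p 0 = 0 := by
  rw [encodeRotationTable_eq]
  refine List.getD_eq_default _ _ ?_
  simp
  omega

end Codes

/-! ### Building the table -/

namespace RAMState

variable {n : ℕ} (G : RotationDigraph (Fin n) (Fin (2 * n)))
  (a : Fin n → Fin 4 → Fin (2 * n) × Bool)

/-- The memory after the darts in `S` have been entered into the table. -/
structure TableInv (S : Set (Fin (2 * n) × Bool)) (mem : ℕ → ℕ) : Prop where
  input : ∀ (v : Fin n) (i : Fin 4), mem (1 + 4 * v + i) = dartCode (a v i)
  table : ∀ d ∈ S, mem (4 * n + 1 + dartCode d) = dartCode (G.rot d) ∧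
    mem (8 * n + 1 + dartCode d) = dartCode (G.rot d)
  marks : ∀ p, 12 * n < p → mem p = 0
  le : ∀ p, mem p ≤ 16 * n + 1

variable {G a} {S : Set (Fin (2 * n) × Bool)} {mem reg : ℕ → ℕ}

lemma TableInv.insert (h : TableInv G a S mem) (d : Fin (2 * n) × Bool) :
    TableInv G a (insert d S) (Function.update (Function.update mem
      (4 * n + 1 + dartCode d) (dartCode (G.rot d)))
      (4 * n + 1 + dartCode d + 4 * n) (dartCode (G.rot d))) := by
  have hd := dartCode_lt d
  have hr := dartCode_lt (G.rot d)
  refine ⟨fun v i => ?_, fun d' hd' => ?_, fun p hp => ?_,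
    update_le (update_le h.le (by omega)) (by omega)⟩
  · rw [Function.update_of_ne (by omega), Function.update_of_ne (by omega), h.input]
  · by_cases hdd : d' = d
    · subst hdd
      rw [Function.update_of_ne (by omega), Function.update_self,
        show 8 * n + 1 + dartCode d' = 4 * n + 1 + dartCode d' + 4 * n by ring,
        Function.update_self]
      exact ⟨rfl, rfl⟩
    · have hne : dartCode d' ≠ dartCode d := fun h => hdd (dartCode_injective h)
      have hd2 := dartCode_lt d'
      rw [Function.update_of_ne (by omega), Function.update_of_ne (by omega),
        Function.update_of_ne (by omega), Function.update_of_ne (by omega)]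
      exact h.table d' (hd'.resolve_left hdd)
  · rw [Function.update_of_ne (by omega), Function.update_of_ne (by omega), h.marks p hp]

lemma TableInv.mono {S' : Set (Fin (2 * n) × Bool)} (h : TableInv G a S mem) (hS : S' ⊆ S) :
    TableInv G a S' mem :=
  ⟨h.input, fun d hd => h.table d (hS hd), h.marks, h.le⟩

/-- One round of the first loop of `faceProgram` enters the darts at the vertex `j` into the
table. -/
lemma run_build (ha : G.IsRotationTable a) {j k : ℕ} (hjk : j + (k + 1) = n)
    (hreg : ConstRegs n reg) (h5 : reg 5 = k + 1) (h6 : reg 6 = 1 + 4 * j)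
    (hmem : TableInv G a {d | (G.tail d : ℕ) < j} mem) :
    ∃ reg' mem', run faceProgram ⟨10, reg, mem⟩ 27 = ⟨10, reg', mem'⟩ ∧ ConstRegs n reg' ∧
      reg' 5 = k ∧ reg' 6 = 1 + 4 * (j + 1) ∧
      TableInv G a {d | (G.tail d : ℕ) < j + 1} mem' := by
  obtain ⟨s', hs'⟩ : ∃ s', run faceProgram ⟨10, reg, mem⟩ 27 = s' := ⟨_, rfl⟩
  let v : Fin n := ⟨j, by omega⟩
  have e0 : mem (1 + 4 * j) = dartCode (a v 0) := hmem.input v 0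
  have e1 : mem (1 + 4 * j + 1) = dartCode (a v 1) := hmem.input v 1
  have e2 : mem (1 + 4 * j + 1 + 1) = dartCode (a v 2) := hmem.input v 2
  have e3 : mem (1 + 4 * j + 1 + 1 + 1) = dartCode (a v 3) := hmem.input v 3
  have l0 := dartCode_lt (a v 0)
  have l1 := dartCode_lt (a v 1)
  have l2 := dartCode_lt (a v 2)
  have l3 := dartCode_lt (a v 3)
  rw [hs']
  simp [run_succ, run_zero, step, exec, faceProgram, h5, h6, hreg.reg1, hreg.reg2, hreg.reg4,
    hreg.reg15, e0, e1, e2, e3] at hs'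
  subst hs'
  refine ⟨_, _, rfl, ?_, by simp, by simp; ring, ?_⟩
  · constructor
    case le =>
      repeat' apply update_le
      all_goals first | exact hreg.le | omega
    all_goals simp [hreg.reg0, hreg.reg1, hreg.reg2, hreg.reg3, hreg.reg4, hreg.reg8, hreg.reg9,
      hreg.reg15]
  · have h0 := (((hmem.insert (a v 0)).insert (a v 1)).insert (a v 2)).insert (a v 3)
    rw [(ha v 0).2, (ha v 1).2, (ha v 2).2, (ha v 3).2] at h0
    refine h0.mono fun d hd => ?_
    by_cases hdj : (G.tail d : ℕ) < j
    · simp [hdj]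
    · obtain ⟨i, hi⟩ := ha.exists_eq d
      have hv : G.tail d = v := Fin.ext (by
        have : (G.tail d : ℕ) < j + 1 := hd
        change (G.tail d : ℕ) = j
        omega)
      rw [hv] at hi
      subst hi
      fin_cases i <;> simp

lemma reaches_build (ha : G.IsRotationTable a) (k : ℕ) {j : ℕ} (hjk : j + k = n)
    (hreg : ConstRegs n reg) (h5 : reg 5 = k) (h6 : reg 6 = 1 + 4 * j)
    (hmem : TableInv G a {d | (G.tail d : ℕ) < j} mem) :
    ∃ reg' mem', Reaches faceProgram (2 ^ 30 * (16 * n + 1)) (30 * k)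
      ⟨10, reg, mem⟩ ⟨10, reg', mem'⟩ ∧ ConstRegs n reg' ∧ reg' 5 = 0 ∧
      TableInv G a Set.univ mem' := by
  induction k generalizing j reg mem with
  | zero =>
    refine ⟨reg, mem, ⟨0, le_rfl, rfl, fun i hi k => ?_⟩, hreg, h5, hmem.mono fun d _ => ?_⟩
    · obtain rfl : i = 0 := by omega
      have h1 := hreg.le k
      have h2 := hmem.le k
      simp only [run_zero]
      omega
    · have := (G.tail d).isLt
      change (G.tail d : ℕ) < j
      omega
  | succ k ih =>
    obtain ⟨reg1, mem1, hrun, hreg1, h51, h61, hmem1⟩ := run_build ha hjk hreg h5 h6 hmem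
    obtain ⟨reg2, mem2, hrun2, h2⟩ := ih (by omega) hreg1 h51 h61 hmem1
    refine ⟨reg2, mem2, ?_, h2⟩
    have hb : Bounded (16 * n + 1) ⟨10, reg, mem⟩ := fun k => ⟨hreg.le k, hmem.le k⟩
    exact ((hb.reaches (by omega) (by norm_num) hrun).trans hrun2).mono (by omega)

/-! ### The search -/

variable (G)

/-- The memory during the search, when the darts in `M` have been visited. -/
structure SearchMem (M : Finset (Fin (2 * n) × Bool)) (mem : ℕ → ℕ) : Prop where
  table : ∀ d, mem (6 * n + 1 + dartCode d) = dartCode (G.faceStep d)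
  marks : ∀ d, mem (12 * n + 1 + dartCode d) = if d ∈ M then 1 else 0
  le : ∀ p, mem p ≤ 16 * n + 1

variable {G} {M : Finset (Fin (2 * n) × Bool)}

lemma TableInv.searchMem (h : TableInv G a Set.univ mem) : SearchMem G ∅ mem := by
  refine ⟨fun d => ?_, fun d => ?_, h.le⟩
  · change _ = dartCode (G.rot (RotationDigraph.rev d))
    obtain ⟨h1, h2⟩ := h.table (RotationDigraph.rev d) trivial
    rcases dartCode_rev d with h3 | h3
    · rw [← h1]; congr 1; omega
    · rw [← h2]; congr 1; omega
  · rw [h.marks _ (by omega)]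
    simp

lemma SearchMem.visit (h : SearchMem G M mem) (d : Fin (2 * n) × Bool) :
    SearchMem G (insert d M) (Function.update mem (12 * n + 1 + dartCode d) 1) := by
  refine ⟨fun d' => ?_, fun d' => ?_, update_le h.le (by omega)⟩
  · have := dartCode_lt d'
    rw [Function.update_of_ne (by omega), h.table]
  · by_cases hd : d' = d
    · subst hd; simp
    · have hne : dartCode d' ≠ dartCode d := fun h => hd (dartCode_injective h)
      rw [Function.update_of_ne (by omega), h.marks]
      simp [hd]

/-- The invariant of the main loop of `faceProgram`: either the search is complete and has found no
monochromatic orbit, or it is at the dart `cur`. -/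
structure SearchInv (G : RotationDigraph (Fin n) (Fin (2 * n))) (i : ℕ)
    (M : Finset (Fin (2 * n) × Bool)) (reg mem : ℕ → ℕ) : Prop where
  regs : ConstRegs n reg
  mem : SearchMem G M mem
  reg5 : reg 5 = i
  reg7 : reg 7 ≤ M.card + 1
  trace : (i = 0 ∧ ∀ d, ∃ k : ℕ, (G.faceStep^[k] d).2 ≠ d.2) ∨
    ∃ cur, reg 6 = dartCode cur ∧ TraceInv G.faceStep Prod.snd dartCode i cur (reg 7) M

lemma card_le (M : Finset (Fin (2 * n) × Bool)) : M.card ≤ 4 * n := by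
  refine (Finset.card_le_univ M).trans ?_
  simp
  omega

lemma SearchInv.run_visit {i : ℕ} (h : SearchInv G i M reg mem) {cur : Fin (2 * n) × Bool}
    (h6 : reg 6 = dartCode cur)
    (htrace : TraceInv G.faceStep Prod.snd dartCode i cur (reg 7) M) (hcur : cur ∉ M) :
    ∃ reg' mem', run faceProgram ⟨40, reg, mem⟩ 17 = ⟨40, reg', mem'⟩ ∧
      SearchInv G i (insert cur M) reg' mem' := by
  obtain ⟨s', hs'⟩ : ∃ s', run faceProgram ⟨40, reg, mem⟩ 17 = s' := ⟨_, rfl⟩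
  have hreg := h.regs
  have hmem := h.mem.visit cur
  have h5 : reg 5 ≠ 0 := by
    obtain ⟨_, s, _, hs, -⟩ := htrace
    rw [h.reg5]
    omega
  have e1 : mem (12 * n + 1 + dartCode cur) = 0 := by rw [h.mem.marks, if_neg hcur]
  have e2 := hmem.table cur
  have l1 := dartCode_lt cur
  have l2 := dartCode_lt (G.faceStep cur)
  have hflag := h.reg7
  have hcard : (insert cur M).card = M.card + 1 := Finset.card_insert_of_notMem hcur
  have hcard' := card_le (insert cur M)
  have hdir := direction_change cur (G.faceStep cur)
  have hdir1 : (if (G.faceStep cur).2 = cur.2 then 0 else 1) ≤ 1 := by split_ifs <;> omega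
  rw [hs']
  simp [run_succ, run_zero, step, exec, faceProgram, h5, h6, hreg.reg1, hreg.reg2, hreg.reg3,
    hreg.reg8, hreg.reg9, e1, e2, hdir] at hs'
  subst hs'
  refine ⟨_, _, rfl, ?_, hmem, by simp [h.reg5], by simp; omega,
    Or.inr ⟨G.faceStep cur, by simp, ?_⟩⟩
  · constructor
    case le =>
      repeat' apply update_le
      all_goals first | exact hreg.le | omega
    all_goals simp [hreg.reg0, hreg.reg1, hreg.reg2, hreg.reg3, hreg.reg4, hreg.reg8, hreg.reg9,
      hreg.reg15]
  · simpa using htrace.visit hcur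

lemma SearchInv.run_close {i : ℕ} (h : SearchInv G (i + 1) M reg mem) {cur : Fin (2 * n) × Bool}
    (h6 : reg 6 = dartCode cur)
    (htrace : TraceInv G.faceStep Prod.snd dartCode (i + 1) cur (reg 7) M) (hcur : cur ∈ M)
    (h7 : reg 7 ≠ 0) :
    ∃ reg', run faceProgram ⟨40, reg, mem⟩ 10 = ⟨40, reg', mem⟩ ∧ SearchInv G i M reg' mem := by
  obtain ⟨s', hs'⟩ : ∃ s', run faceProgram ⟨40, reg, mem⟩ 10 = s' := ⟨_, rfl⟩
  have hreg := h.regs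
  have hi : i + 1 ≤ 4 * n := by
    obtain ⟨_, s, _, hs, -⟩ := htrace
    have := dartCode_lt s
    omega
  have e1 : mem (12 * n + 1 + dartCode cur) = 1 := by rw [h.mem.marks, if_pos hcur]
  obtain ⟨hM, hMi⟩ := htrace.isCleared hcur h7 dartCode_injective
  obtain ⟨s, hs⟩ := exists_dartCode_eq (n := n) (k := i - 1) (by omega)
  have e2 : mem (12 * n + 1 + (i - 1)) = if s ∈ M then 1 else 0 := by rw [← hs, h.mem.marks]
  have l1 := dartCode_lt cur
  have hmark : (if s ∈ M then 1 else 0) ≤ 1 := by split_ifs <;> omega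
  rw [hs']
  simp [run_succ, run_zero, step, exec, faceProgram, h.reg5, h6, h7, hreg.reg1, hreg.reg2,
    hreg.reg9, e1, e2] at hs'
  subst hs'
  refine ⟨_, rfl, ?_, h.mem, by simp, by simp; omega, ?_⟩
  · constructor
    case le =>
      repeat' apply update_le
      all_goals first | exact hreg.le | omega
    all_goals simp [hreg.reg0, hreg.reg1, hreg.reg2, hreg.reg3, hreg.reg4, hreg.reg8, hreg.reg9,
      hreg.reg15]
  · rcases Nat.eq_zero_or_pos i with rfl | hi0
    · exact Or.inl ⟨rfl, fun d => hM.exists_ne d (hMi d (by omega))⟩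
    · refine Or.inr ⟨s, by simp [hs], ?_⟩
      simpa using hM.traceInv hMi (s := s) (by omega)

/-- The main loop decides whether there is a monochromatic orbit. The sum of the counter and the
number of unvisited darts decreases in every round. -/
lemma SearchInv.reaches (μ : ℕ) {i : ℕ} (hμ : i + (4 * n - M.card) = μ)
    (h : SearchInv G i M reg mem) :
    ∃ s', Reaches faceProgram (2 ^ 30 * (16 * n + 1)) (30 * (μ + 1)) ⟨40, reg, mem⟩ s' ∧
      s'.Halted faceProgram ∧
      ((s'.reg 0 = 1 ∧ ∀ d, ∃ k : ℕ, (G.faceStep^[k] d).2 ≠ d.2) ∨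
        (s'.reg 0 = 0 ∧ ¬ ∀ d, ∃ k : ℕ, (G.faceStep^[k] d).2 ≠ d.2)) := by
  induction μ using Nat.strong_induction_on generalizing i M reg mem with
  | _ μ ih =>
    have hb : Bounded (16 * n + 1) ⟨40, reg, mem⟩ := fun k => ⟨h.regs.le k, h.mem.le k⟩
    have hreach : ∀ {t s'}, t ≤ 30 → run faceProgram ⟨40, reg, mem⟩ t = s' →
        Reaches faceProgram (2 ^ 30 * (16 * n + 1)) 30 ⟨40, reg, mem⟩ s' :=
      fun ht h => hb.reaches (by omega) ht h
    rcases h.trace with ⟨rfl, hall⟩ | ⟨cur, h6, htrace⟩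
    · refine ⟨_, (hreach (t := 2) (by norm_num) rfl).mono (by omega), ?_, Or.inl ⟨?_, hall⟩⟩
      · simp [Halted, run_succ, run_zero, step, exec, faceProgram, h.reg5]
      · simp [run_succ, run_zero, step, exec, faceProgram, h.reg5, h.regs.reg1, h.regs.reg2]
    · have hcard := card_le M
      by_cases hcur : cur ∈ M
      · by_cases h7 : reg 7 = 0
        · rw [h7] at htrace
          have h5 : reg 5 ≠ 0 := by
            obtain ⟨_, s, _, hs, -⟩ := htrace
            rw [h.reg5]
            omega
          have e1 : mem (12 * n + 1 + dartCode cur) = 1 := by rw [h.mem.marks, if_pos hcur]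
          refine ⟨_, (hreach (t := 5) (by norm_num) rfl).mono (by omega), ?_, Or.inr ⟨?_, ?_⟩⟩
          · simp [Halted, run_succ, run_zero, step, exec, faceProgram, h5, h6, h7, h.regs.reg9, e1]
          · simp [run_succ, run_zero, step, exec, faceProgram, h5, h6, h7, h.regs.reg9, e1,
              h.regs.reg0]
          · obtain ⟨d, hd⟩ := htrace.exists_monochromatic hcur
            exact fun hall => (hall d).elim fun k hk => hk (hd k)
        · obtain ⟨i, rfl⟩ : ∃ j, i = j + 1 := by
            obtain ⟨_, s, _, hs, -⟩ := htrace
            exact ⟨_, hs.symm⟩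
          obtain ⟨reg', hrun, h'⟩ := h.run_close h6 htrace hcur h7
          obtain ⟨s', hs', hfin⟩ := ih (μ - 1) (by omega) (by omega) h'
          exact ⟨s', ((hreach (by norm_num) hrun).trans hs').mono (by omega), hfin⟩
      · obtain ⟨reg', mem', hrun, h'⟩ := h.run_visit h6 htrace hcur
        have hcard2 : (insert cur M).card = M.card + 1 := Finset.card_insert_of_notMem hcur
        have hcard' := card_le (insert cur M)
        obtain ⟨s', hs', hfin⟩ := ih (μ - 1) (by omega) (by omega) h'
        exact ⟨s', ((hreach (by norm_num) hrun).trans hs').mono (by omega), hfin⟩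

lemma run_init (hn : 0 < n) (a : Fin n → Fin 4 → Fin (2 * n) × Bool) :
    ∃ reg, run faceProgram (init (encodeRotationTable a)) 10 =
      ⟨10, reg, (init (encodeRotationTable a)).mem⟩ ∧ ConstRegs n reg ∧ reg 5 = n ∧ reg 6 = 1 := by
  obtain ⟨s', hs'⟩ : ∃ s', run faceProgram (init (encodeRotationTable a)) 10 = s' := ⟨_, rfl⟩
  have h0 : (encodeRotationTable a).getD 0 0 = n := by rw [encodeRotationTable]; rfl
  rw [hs']
  simp only [init] at hs'
  generalize hx : (fun k => (encodeRotationTable a).getD k 0) = x at hs'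
  have hx0 : x 0 = n := by rw [← hx]; exact h0
  simp [run_succ, run_zero, step, exec, faceProgram, hx0] at hs'
  subst hs'
  refine ⟨_, by rw [init, hx], ?_, by simp, by simp⟩
  constructor
  case le =>
    repeat' apply update_le
    all_goals omega
  all_goals simp
  all_goals omega

lemma tableInv_init (a : Fin n → Fin 4 → Fin (2 * n) × Bool) :
    TableInv G a ∅ (init (encodeRotationTable a)).mem := by
  refine ⟨getD_encodeRotationTable a, by simp,
    fun p hp => getD_encodeRotationTable_of_lt a (by omega), fun p => ?_⟩
  change (encodeRotationTable a).getD p 0 ≤ _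
  by_cases hp : p < (encodeRotationTable a).length
  · rw [List.getD_eq_getElem _ _ hp]
    have hmem := List.getElem_mem hp
    generalize (encodeRotationTable a)[p] = x at hmem
    rw [encodeRotationTable_eq, List.mem_cons, List.mem_ofFn] at hmem
    rcases hmem with h | ⟨i, h⟩
    · omega
    · rw [← h]
      exact (dartCode_lt _).le.trans (by omega)
  · rw [List.getD_eq_default _ _ (by omega)]
    exact Nat.zero_le _

theorem faceProgram_computes (hn : 0 < n) (ha : G.IsRotationTable a) :
    ∃ out, Computes faceProgram (encodeRotationTable a) out (2 ^ 35 * n) (2 ^ 35 * n) ∧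
      ((out = 1 ∧ ∀ d, ∃ k : ℕ, (G.faceStep^[k] d).2 ≠ d.2) ∨
        (out = 0 ∧ ¬ ∀ d, ∃ k : ℕ, (G.faceStep^[k] d).2 ≠ d.2)) := by
  have hinit := tableInv_init (G := G) a
  obtain ⟨reg1, hrun1, hreg1, h51, h61⟩ := run_init hn a
  have hb0 : Bounded (16 * n + 1) (init (encodeRotationTable a)) :=
    fun k => ⟨Nat.zero_le _, hinit.le k⟩
  obtain ⟨reg2, mem2, hrun2, hreg2, h52, hmem2⟩ := reaches_build ha n (j := 0) (by omega) hreg1 h51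
    (by simpa using h61) (hinit.mono fun d hd => absurd hd (Nat.not_lt_zero _))
  have hb2 : Bounded (16 * n + 1) ⟨10, reg2, mem2⟩ := fun k => ⟨hreg2.le k, hmem2.le k⟩
  obtain ⟨reg3, hrun3, h3⟩ : ∃ reg3, run faceProgram ⟨10, reg2, mem2⟩ 4 = ⟨40, reg3, mem2⟩ ∧
      SearchInv G (4 * n) ∅ reg3 mem2 := by
    obtain ⟨s', hs'⟩ : ∃ s', run faceProgram ⟨10, reg2, mem2⟩ 4 = s' := ⟨_, rfl⟩
    rw [hs']
    simp [run_succ, run_zero, step, exec, faceProgram, h52, hreg2.reg1, hreg2.reg2,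
      hreg2.reg4] at hs'
    subst hs'
    obtain ⟨s, hs⟩ := exists_dartCode_eq (n := n) (k := 4 * n - 1) (by omega)
    refine ⟨_, rfl, ?_, hmem2.searchMem, by simp, by simp, Or.inr ⟨s, by simp [hs], ?_⟩⟩
    · constructor
      case le =>
        repeat' apply update_le
        all_goals first | exact hreg2.le | omega
      all_goals simp [hreg2.reg0, hreg2.reg1, hreg2.reg2, hreg2.reg3, hreg2.reg4, hreg2.reg8,
        hreg2.reg9, hreg2.reg15]
    · have hcl : IsCleared G.faceStep Prod.snd (∅ : Finset (Fin (2 * n) × Bool)) :=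
        ⟨by simp, by simp⟩
      simpa using hcl.traceInv (code := dartCode) (i := 4 * n) (s := s)
        (fun d hd => absurd (dartCode_lt d) (by omega)) (by omega)
  obtain ⟨s', hs', hhalt, hout⟩ := h3.reaches (8 * n) (by simp; omega)
  have hall := (((hb0.reaches (by omega) (by norm_num) hrun1).trans hrun2).trans
    (hb2.reaches (by omega) (by norm_num) hrun3)).trans hs'
  obtain ⟨t, ht, rfl, hbound⟩ := hall
  -- `2 ^ 30 * (16 * n + 1) ≤ 2 ^ 30 * (17 * n)`, and the number of steps is far smaller
  refine ⟨_, ⟨t, by omega, hhalt, rfl, fun i hi k => ?_⟩, hout⟩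
  have h1 := hbound i hi k
  omega

end RAMState

/-! ### Contractible directed circuits on the torus -/

theorem mainTheorem3 :
    (∀ (V : Type*) (E : Type*) [Finite V] [Finite E] (G : RotationDigraph V E),
      G.IsTwoTwoRegular → G.IsToroidal →
        ((∃ c : List E, G.IsDirectedCircuit c ∧
            G.Contractible (RotationDigraph.along c)) →
          ∃ (f : G.Face) (c : List E), G.IsDirectedCircuit c ∧
            G.Contractible (RotationDigraph.along c) ∧ G.Bounds c f) ∧
        (G.AllCircuitsNoncontractible ↔ ¬ ∃ (f : G.Face) (c : List E), G.Bounds c f)) ∧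
    ∃ (P : List RAMInstr) (K : ℕ),
      ∀ (n m : ℕ) (G : RotationDigraph (Fin n) (Fin m)) (a : Fin n → Fin 4 → Fin m × Bool),
        G.IsTwoTwoRegular → G.IsToroidal → G.IsRotationTable a →
          ∃ out : ℕ, RAMState.Computes P (encodeRotationTable a) out (K * n) (K * n) ∧
            ((out = 1 ∧ G.AllCircuitsNoncontractible) ∨
              (out = 0 ∧ ¬ G.AllCircuitsNoncontractible)) := by
  refine ⟨fun V E _ _ G hG _ => ⟨fun h => ?_, hG.allCircuitsNoncontractible_iff⟩,
    faceProgram, 2 ^ 35, fun n m G a hG hT ha => ?_⟩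
  · obtain ⟨f, c, hc⟩ := hG.exists_bounds h
    exact ⟨f, c, hc.1, hc.contractible, hc⟩
  · obtain rfl := hG.card_eq
    have hn : 0 < n := Fin.pos_iff_nonempty.2 hT.1.1
    simp only [hG.allCircuitsNoncontractible_iff_forall]
    exact RAMState.faceProgram_computes hn ha
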